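/- Let $\kappa$ be a regular (in particular infinite) cardinal and let $\theta<\kappa^+$ be an ordinal. For a $C^*$-algebra $\mathcal A$, a minimal projection is a nonzero projection $p\in\mathcal A$ with $p\mathcal A p=\mathbb C p$, and $\mathcal I^{At}(\mathcal A)$ denotes the norm-closed $*$-subalgebra of $\mathcal A$ generated by the minimal projections of $\mathcal A$. The algebra $\mathcal A$ is called scattered if $\mathcal I^{At}(\mathcal B)\neq\{0\}$ for every nonzero $C^*$-subalgebra $\mathcal B\subseteq\mathcal A$. The Cantor--Bendixson sequence of a scattered $\mathcal A$ is the unique increasing sequence $(\mathcal I_\alpha)_{\alpha\le ht(\mathcal A)}$ of closed two-sided ideals, indexed by ordinals, with $\mathcal I_0=\{0\}$, $\mathcal I_\gamma=\overline{\bigcup_{\alpha<\gamma}\mathcal I_\alpha}$ for limit $\gamma\le ht(\mathcal A)$, $\mathcal I^{At}(\mathcal A/\mathcal I_\alpha)=\{[a]_{\mathcal I_\alpha}: a\in\mathcal I_{\alpha+1}\}$ for $\alpha<ht(\mathcal A)$, and such that $ht(\mathcal A)$, the height of $\mathcal A$, is the least ordinal with $\mathcal I_{ht(\mathcal A)}=\mathcal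 A$. The algebra $\mathcal A$ is fully noncommutative if for each $\alpha<ht(\mathcal A)$ the quotient $\mathcal I_{\alpha+1}/\mathcal I_\alpha$ is $*$-isomorphic to the algebra of all compact operators on some Hilbert space; its width $wd(\mathcal A)$ is the supremum of the cardinals $\mu$ such that, for some $\alpha<ht(\mathcal A)$, $\mathcal I_{\alpha+1}/\mathcal I_\alpha$ is $*$-isomorphic to a nondegenerate $C^*$-subalgebra of the algebra $\mathcal K(\ell_2(\mu))$ of compact operators on $\ell_2(\mu)$. The algebra $\mathcal A$ is stable if $\mathcal A\cong\mathcal A\otimes\mathcal K(\ell_2)$. Then there is a scattered $C^*$-algebra $\mathcal A_\theta$ of height $\theta$, with Cantor--Bendixson sequence $(\mathcal I_\alpha)_{\alpha\le\theta}$, such that $\mathcal I_{\alpha+1}/\mathcal I_\alpha$ is $*$-isomorphic to $\mathcal K(\ell_2(\kappa))$ for every $\alpha<\theta$. In particular $\mathcal A_\theta$ is fully noncommutative and, if $\theta\neq 0$, $wd(\mathcal A_\theta)=\kappa$. Moreover $\mathcal A_\theta$ can be chosen to be stable. -/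

import Mathlib

universe u v w

noncomputable section

namespace ScatteredCStar

open scoped TensorProduct

/-! ### Compact operators on a Hilbert space -/

/-- The adjoint of a compact operator on a Hilbert space is compact. -/
theorem isCompactOperator_adjoint {H : Type u} [NormedAddCommGroup H] [InnerProductSpace ℂ H]
    [CompleteSpace H] {T : H →L[ℂ] H} (hT : IsCompactOperator T) :
    IsCompactOperator (star T : H →L[ℂ] H) := by
  have hTT : IsCompactOperator (T ∘L star T : H →L[ℂ] H) := hT.comp_clm (star T)
  have key : TotallyBounded ((T ∘L star T : H →L[ℂ] H) '' Metric.ball 0 1) :=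
    ((hTT.isCompact_closure_image_ball (f := ((T ∘L star T : H →L[ℂ] H) : H →ₗ[ℂ] H))
      1).totallyBounded).subset subset_closure
  have hineq : ∀ x ∈ Metric.ball (0 : H) 1, ∀ y ∈ Metric.ball (0 : H) 1,
      dist (star T x) (star T y) ^ 2 ≤
        2 * dist ((T ∘L star T : H →L[ℂ] H) x) ((T ∘L star T : H →L[ℂ] H) y) := by
    intro x hx y hy
    rw [dist_eq_norm, dist_eq_norm, ← map_sub, ← map_sub]
    have h1 : ‖star T (x - y)‖ ^ 2 = RCLike.re (inner ℂ (T (star T (x - y))) (x - y)) := by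
      rw [← ContinuousLinearMap.adjoint_inner_right, ← ContinuousLinearMap.star_eq_adjoint,
        inner_self_eq_norm_sq]
    rw [h1]
    have h2 : ‖x - y‖ ≤ 2 := by
      have hx' : ‖x‖ < 1 := by simpa using hx
      have hy' : ‖y‖ < 1 := by simpa using hy
      linarith [norm_sub_le x y]
    calc RCLike.re (inner ℂ (T (star T (x - y))) (x - y))
        ≤ ‖T (star T (x - y))‖ * ‖x - y‖ :=
          (RCLike.re_le_norm _).trans (norm_inner_le_norm _ _)
      _ ≤ ‖T (star T (x - y))‖ * 2 := by gcongr
      _ = 2 * ‖(T ∘L star T : H →L[ℂ] H) (x - y)‖ := by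
          rw [mul_comm]; rfl
  have htb : TotallyBounded ((star T : H →L[ℂ] H) '' Metric.ball 0 1) := by
    rw [Metric.totallyBounded_iff]
    intro ε hε
    obtain ⟨t, ht, htf, hcov⟩ := Metric.finite_approx_of_totallyBounded key (ε ^ 2 / 2)
      (by positivity)
    choose! g hg hgt using fun z (hz : z ∈ t) => ht hz
    refine ⟨(fun z => star T (g z)) '' t, htf.image _, ?_⟩
    rintro _ ⟨x, hx, rfl⟩
    have := hcov (Set.mem_image_of_mem _ hx)
    simp only [Set.mem_iUnion, Metric.mem_ball, exists_prop] at this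
    obtain ⟨z, hz, hxz⟩ := this
    simp only [Set.mem_iUnion, Metric.mem_ball, exists_prop]
    refine ⟨_, ⟨z, hz, rfl⟩, ?_⟩
    have h3 := hineq x hx (g z) (hg z hz)
    rw [hgt z hz] at h3
    exact lt_of_pow_lt_pow_left₀ 2 hε.le (by linarith)
  refine (isCompactOperator_iff_isCompact_closure_image_ball
    (f := ((star T : H →L[ℂ] H) : H →ₗ[ℂ] H)) zero_lt_one).2 ?_
  exact htb.closure.isCompact_of_isClosed isClosed_closure

/-- `𝓚(H)`: the `*`-algebra of all compact operators on a complex Hilbert space `H`. -/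
def compactOps (H : Type u) [NormedAddCommGroup H] [InnerProductSpace ℂ H] [CompleteSpace H] :
    NonUnitalStarSubalgebra ℂ (H →L[ℂ] H) where
  carrier := {T | IsCompactOperator T}
  add_mem' hf hg := hf.add hg
  zero_mem' := isCompactOperator_zero
  smul_mem' c _ hf := hf.smul c
  mul_mem' {_ g} hf _ := hf.comp_clm g
  star_mem' hf := isCompactOperator_adjoint hf

/-- The Hilbert space `ℓ₂(ι)` over `ℂ`. -/
abbrev EllTwo (ι : Type u) : Type u := lp (fun _ : ι => ℂ) 2

/-! ### Minimal projections and the algebra they generate -/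

/-- A minimal projection: a nonzero projection `p` with `p A p = ℂ p`. -/
structure IsMinimalProjection {A : Type u} [NonUnitalRing A] [StarRing A] [Module ℂ A]
    (p : A) : Prop where
  isStarProjection : IsStarProjection p
  ne_zero : p ≠ 0
  corner : ∀ a : A, ∃ c : ℂ, p * a * p = c • p

/-- `𝓘ᴬᵗ(A)`: the norm-closed `*`-subalgebra generated by the minimal projections
(as a set; the topology on `A` is the norm topology wherever this is used). -/
def atomIdeal (A : Type u) [NonUnitalRing A] [StarRing A] [Module ℂ A] [IsScalarTower ℂ A A]
    [SMulCommClass ℂ A A] [StarModule ℂ A] [TopologicalSpace A] : Set A :=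
  closure (NonUnitalStarAlgebra.adjoin ℂ {p : A | IsMinimalProjection p} : Set A)

/-- `A` is scattered if `𝓘ᴬᵗ(B) ≠ 0` for every nonzero `C*`-subalgebra `B` of `A`. -/
def IsScattered (A : Type u) [NonUnitalCStarAlgebra A] : Prop :=
  ∀ B : NonUnitalStarSubalgebra ℂ A, IsClosed (B : Set A) → B ≠ ⊥ →
    ∃ b ∈ atomIdeal B, b ≠ 0

/-! ### Closed ideals and quotients -/

/-- Closed two-sided ideals of a `C*`-algebra. (Such ideals are automatically self-adjoint linear
subspaces; recording this makes the quotient a `*`-algebra.) -/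
structure ClosedIdeal (A : Type u) [NonUnitalCStarAlgebra A] extends
    NonUnitalStarSubalgebra ℂ A where
  isClosed : IsClosed carrier
  mul_mem_left : ∀ (a : A) {x : A}, x ∈ carrier → a * x ∈ carrier
  mul_mem_right : ∀ (a : A) {x : A}, x ∈ carrier → x * a ∈ carrier

namespace ClosedIdeal

variable {A : Type u} [NonUnitalCStarAlgebra A] (I : ClosedIdeal A)

/-- The underlying linear subspace. -/
abbrev sub : Submodule ℂ A := I.toNonUnitalSubalgebra.toSubmodule

/-- The quotient `A / I`, with the quotient norm. -/
def QuotientAlg : Type u := A ⧸ I.sub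

instance : IsClosed (I.sub : Set A) := I.isClosed

instance : NormedAddCommGroup I.QuotientAlg := inferInstanceAs (NormedAddCommGroup (A ⧸ I.sub))

instance : NormedSpace ℂ I.QuotientAlg := inferInstanceAs (NormedSpace ℂ (A ⧸ I.sub))

/-- The class `[a]` of `a` in `A / I`. -/
def cls (a : A) : I.QuotientAlg := I.sub.mkQ a

theorem cls_surjective : Function.Surjective I.cls := I.sub.mkQ_surjective

theorem cls_eq_cls_iff {a b : A} : I.cls a = I.cls b ↔ a - b ∈ I.carrier :=
  Submodule.Quotient.eq I.sub

theorem cls_add (a b : A) : I.cls (a + b) = I.cls a + I.cls b := rfl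

theorem cls_smul (c : ℂ) (a : A) : I.cls (c • a) = c • I.cls a := rfl

instance : Mul I.QuotientAlg where
  mul := Quotient.map₂ (· * ·) (by
    intro a a' ha b b' hb
    have ha' : a - a' ∈ I.carrier := (Submodule.quotientRel_def I.sub).1 ha
    have hb' : b - b' ∈ I.carrier := (Submodule.quotientRel_def I.sub).1 hb
    refine (Submodule.quotientRel_def I.sub).2 ?_
    have h : a * b - a' * b' = a * (b - b') + (a - a') * b' := by
      rw [mul_sub, sub_mul]; abel
    rw [h]
    exact I.add_mem' (I.mul_mem_left _ hb') (I.mul_mem_right _ ha'))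

instance : Star I.QuotientAlg where
  star := Quotient.map star (by
    intro a a' ha
    have ha' : a - a' ∈ I.carrier := (Submodule.quotientRel_def I.sub).1 ha
    refine (Submodule.quotientRel_def I.sub).2 ?_
    rw [← star_sub]
    exact I.star_mem' ha')

theorem cls_mul (a b : A) : I.cls (a * b) = I.cls a * I.cls b := rfl

theorem cls_star (a : A) : I.cls (star a) = star (I.cls a) := rfl

instance : NonUnitalRing I.QuotientAlg :=
  { (inferInstance : AddCommGroup I.QuotientAlg), (inferInstance : Mul I.QuotientAlg) with
    left_distrib := by
      intro x y z
      obtain ⟨a, rfl⟩ := I.cls_surjective x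
      obtain ⟨b, rfl⟩ := I.cls_surjective y
      obtain ⟨c, rfl⟩ := I.cls_surjective z
      exact congrArg I.cls (mul_add a b c)
    right_distrib := by
      intro x y z
      obtain ⟨a, rfl⟩ := I.cls_surjective x
      obtain ⟨b, rfl⟩ := I.cls_surjective y
      obtain ⟨c, rfl⟩ := I.cls_surjective z
      exact congrArg I.cls (add_mul a b c)
    zero_mul := by
      intro x
      obtain ⟨a, rfl⟩ := I.cls_surjective x
      exact congrArg I.cls (zero_mul a)
    mul_zero := by
      intro x
      obtain ⟨a, rfl⟩ := I.cls_surjective x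
      exact congrArg I.cls (mul_zero a)
    mul_assoc := by
      intro x y z
      obtain ⟨a, rfl⟩ := I.cls_surjective x
      obtain ⟨b, rfl⟩ := I.cls_surjective y
      obtain ⟨c, rfl⟩ := I.cls_surjective z
      exact congrArg I.cls (mul_assoc a b c) }

instance : StarRing I.QuotientAlg where
  star_involutive := by
    intro x
    obtain ⟨a, rfl⟩ := I.cls_surjective x
    exact congrArg I.cls (star_star a)
  star_mul := by
    intro x y
    obtain ⟨a, rfl⟩ := I.cls_surjective x
    obtain ⟨b, rfl⟩ := I.cls_surjective y
    exact congrArg I.cls (star_mul a b)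
  star_add := by
    intro x y
    obtain ⟨a, rfl⟩ := I.cls_surjective x
    obtain ⟨b, rfl⟩ := I.cls_surjective y
    exact congrArg I.cls (star_add a b)

instance : StarModule ℂ I.QuotientAlg where
  star_smul := by
    intro c x
    obtain ⟨a, rfl⟩ := I.cls_surjective x
    exact congrArg I.cls (star_smul c a)

instance : IsScalarTower ℂ I.QuotientAlg I.QuotientAlg where
  smul_assoc := by
    intro c x y
    obtain ⟨a, rfl⟩ := I.cls_surjective x
    obtain ⟨b, rfl⟩ := I.cls_surjective y
    exact congrArg I.cls (smul_mul_assoc c a b)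

instance : SMulCommClass ℂ I.QuotientAlg I.QuotientAlg where
  smul_comm := by
    intro c x y
    obtain ⟨a, rfl⟩ := I.cls_surjective x
    obtain ⟨b, rfl⟩ := I.cls_surjective y
    exact congrArg I.cls (mul_smul_comm c a b).symm

/-- The quotient map `A → A / I` as a `*`-homomorphism. -/
def mkHom : A →⋆ₙₐ[ℂ] I.QuotientAlg where
  toFun := I.cls
  map_smul' _ _ := rfl
  map_zero' := rfl
  map_add' _ _ := rfl
  map_mul' _ _ := rfl
  map_star' _ := rfl

/-- The `*`-algebra `J / I`, realized as the image `{[a] : a ∈ J}` of `J` in `A / I`. -/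
def subquotient (J I : ClosedIdeal A) : NonUnitalStarSubalgebra ℂ I.QuotientAlg :=
  J.toNonUnitalStarSubalgebra.map I.mkHom

end ClosedIdeal

/-! ### Cantor–Bendixson sequences -/

/-- The Cantor–Bendixson sequence `(𝓘_α)_{α ≤ height}` of `A` (only the values of `ideal` at
ordinals `≤ height` matter): it is increasing and continuous, starts at `0`, satisfies
`𝓘ᴬᵗ(A / 𝓘_α) = {[a] : a ∈ 𝓘_{α+1}}`, and `height` is the first ordinal at which it reaches `A`.
The height and the ideals up to it are unique, see `CantorBendixson.unique`. -/
structure CantorBendixson (A : Type u) [NonUnitalCStarAlgebra A] where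
  height : Ordinal.{u}
  ideal : Ordinal.{u} → ClosedIdeal A
  ideal_zero : (ideal 0).carrier = {0}
  mono : ∀ α β, α ≤ β → β ≤ height → (ideal α).carrier ⊆ (ideal β).carrier
  limit : ∀ γ, γ ≤ height → Order.IsSuccLimit γ →
    (ideal γ).carrier = closure (⋃ α ∈ Set.Iio γ, (ideal α).carrier)
  succ : ∀ α, α < height →
    atomIdeal (ideal α).QuotientAlg = (ideal α).cls '' (ideal (Order.succ α)).carrier
  ideal_height : (ideal height).carrier = Set.univ
  ne_univ : ∀ α, α < height → (ideal α).carrier ≠ Set.univ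

namespace CantorBendixson

variable {A : Type u} [NonUnitalCStarAlgebra A]

theorem ideal_ext {I J : ClosedIdeal A} (h : I.carrier = J.carrier) : I = J := by
  obtain ⟨⟨⟨⟨⟨⟨I, _⟩, _⟩, _⟩, _⟩, _⟩, _, _, _⟩ := I
  obtain ⟨⟨⟨⟨⟨⟨J, _⟩, _⟩, _⟩, _⟩, _⟩, _, _, _⟩ := J
  congr

theorem ideal_eq (S T : CantorBendixson A) (α : Ordinal.{u}) :
    α ≤ S.height → α ≤ T.height → S.ideal α = T.ideal α := by
  induction α using Ordinal.limitRecOn with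
  | zero => intro _ _; exact ideal_ext (S.ideal_zero.trans T.ideal_zero.symm)
  | add_one α ih =>
    intro hS hT
    have hα : α < α + 1 := Order.lt_succ α
    have e := ih (hα.le.trans hS) (hα.le.trans hT)
    have h1 := S.succ α (hα.trans_le hS)
    have h2 := T.succ α (hα.trans_le hT)
    have hSle := S.mono α (Order.succ α) hα.le hS
    have hTle := T.mono α (Order.succ α) hα.le hT
    rw [e] at h1 hSle
    rw [h1] at h2
    have aux : ∀ J K : ClosedIdeal A, (T.ideal α).carrier ⊆ K.carrier →
        (T.ideal α).cls '' J.carrier = (T.ideal α).cls '' K.carrier → J.carrier ⊆ K.carrier := by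
      intro J K hK hJK x hx
      have : (T.ideal α).cls x ∈ (T.ideal α).cls '' K.carrier := hJK ▸ ⟨x, hx, rfl⟩
      obtain ⟨y, hy, hxy⟩ := this
      have h3 := hK ((T.ideal α).cls_eq_cls_iff.1 hxy.symm)
      simpa using K.add_mem' h3 hy
    exact ideal_ext ((aux _ _ hTle h2).antisymm (aux _ _ hSle h2.symm))
  | limit γ hγ ih =>
    intro hS hT
    refine ideal_ext ?_
    rw [S.limit γ hS hγ, T.limit γ hT hγ]
    congr 1
    refine Set.iUnion₂_congr fun α hα => ?_
    rw [ih α hα (hα.le.trans hS) (hα.le.trans hT)]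

/-- A `C*`-algebra has at most one Cantor–Bendixson sequence. -/
theorem unique (S T : CantorBendixson A) :
    S.height = T.height ∧ ∀ α ≤ S.height, S.ideal α = T.ideal α := by
  have h : S.height = T.height := by
    rcases lt_trichotomy S.height T.height with h | h | h
    · exact absurd (ideal_eq S T _ le_rfl h.le ▸ S.ideal_height) (T.ne_univ _ h)
    · exact h
    · exact absurd (ideal_eq S T _ h.le le_rfl ▸ T.ideal_height) (S.ne_univ _ h)
  exact ⟨h, fun α hα => ideal_eq S T α hα (h ▸ hα)⟩

variable (S : CantorBendixson A)

/-- The quotient `𝓘_{α+1} / 𝓘_α`. -/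
def layer (α : Ordinal.{u}) : NonUnitalStarSubalgebra ℂ (S.ideal α).QuotientAlg :=
  (S.ideal (Order.succ α)).subquotient (S.ideal α)

/-- Every `𝓘_{α+1} / 𝓘_α` is `*`-isomorphic to the algebra of all compact operators on some
Hilbert space. -/
def FullyNoncommutative : Prop :=
  ∀ α, α < S.height → ∃ (H : Type u) (_ : NormedAddCommGroup H) (_ : InnerProductSpace ℂ H)
    (_ : CompleteSpace H), Nonempty (S.layer α ≃⋆ₐ[ℂ] compactOps H)

/-- The `*`-algebra `L` is `*`-isomorphic to a nondegenerate `C*`-subalgebra of `𝓚(ℓ₂(ι))`. -/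
def IsNondegenerateSubalgebraOfCompacts (L : Type v) [NonUnitalRing L] [StarRing L] [Module ℂ L]
    (ι : Type w) : Prop :=
  ∃ B : NonUnitalStarSubalgebra ℂ (EllTwo ι →L[ℂ] EllTwo ι),
    B ≤ compactOps (EllTwo ι) ∧
    IsClosed (B : Set (EllTwo ι →L[ℂ] EllTwo ι)) ∧
    (Submodule.span ℂ {x : EllTwo ι | ∃ T ∈ B, ∃ y, T y = x}).topologicalClosure = ⊤ ∧
    Nonempty (L ≃⋆ₐ[ℂ] B)

/-- `κ` is the width: the supremum of all cardinals `μ` such that some `𝓘_{α+1} / 𝓘_α` is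
isomorphic to a nondegenerate subalgebra of `𝓚(ℓ₂(μ))`. -/
def IsWidth (κ : Cardinal.{u}) : Prop :=
  IsLUB {μ : Cardinal.{u} | ∃ α, α < S.height ∧
    IsNondegenerateSubalgebraOfCompacts (S.layer α) μ.out} κ

end CantorBendixson

/-! ### Stability -/

/-- `C` is a `C*`-tensor product of the `*`-algebras `A` and `B`: it is the completion of the
algebraic tensor product `A ⊗ B` in a `C*`-norm, that is, there is an injective `*`-homomorphism
with dense range from `A ⊗ B` to `C` (given by the bilinear map `φ : (a, b) ↦ a ⊗ b`).
If `B = 𝓚(ℓ₂)`, which is nuclear, then such a `C` is unique up to isomorphism. -/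
def IsCStarTensorProduct (A : Type u) (B : Type v) (C : Type w)
    [NonUnitalRing A] [StarRing A] [Module ℂ A] [NonUnitalRing B] [StarRing B] [Module ℂ B]
    [NonUnitalCStarAlgebra C] : Prop :=
  ∃ φ : A →ₗ[ℂ] B →ₗ[ℂ] C,
    (∀ a a' b b', φ (a * a') (b * b') = φ a b * φ a' b') ∧
    (∀ a b, φ (star a) (star b) = star (φ a b)) ∧
    Function.Injective (TensorProduct.lift φ : A ⊗[ℂ] B → C) ∧
    DenseRange (TensorProduct.lift φ : A ⊗[ℂ] B → C)

/-- `A` is stable: `A ≅ A ⊗ 𝓚(ℓ₂)`. -/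
def IsStable (A : Type u) [NonUnitalCStarAlgebra A] : Prop :=
  ∃ (C : Type u) (_ : NonUnitalCStarAlgebra C),
    IsCStarTensorProduct A (compactOps (EllTwo ℕ)) C ∧ Nonempty (A ≃⋆ₐ[ℂ] C)

end ScatteredCStar

end

/-!
Let `I` be the set of ordinals below `θ` and let the operators act on `ℓ₂((I →₀ κ) × ℕ)`. For each
level `i` the index set splits as (coordinates from `i` on, with `ℕ`) × (coordinates below `i`), so
that `T ↦ T ⊗ 1` embeds the operators on the first factor. The compact operators `k` on the first
factors, amplified to `k ⊗ 1`, span the algebra. An operator of level `j ≥ i` also has the form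
`T ⊗ 1` at level `i`, hence products of operators of levels `i` and `j` have level `min i j`, and
the levels below `α` span a closed ideal `I_α`.

Modulo `I_i` the operators `T ⊗ 1` keep their norm: an element of `I_i` tends to `0` on the slices
whose coordinates below `i` tend to infinity in the infinite set `κ`, while `T ⊗ 1` acts as `T` on
each slice. Thus the algebra modulo `I_i` acts faithfully on `ℓ₂` of the first factor, and
`I_{i+1}` consists of what acts there by compact operators. In an algebra of operators that contains
all compact operators these form the ideal of the minimal projections, so `(I_α)` is the
Cantor–Bendixson sequence. Any nonzero closed `*`-subalgebra meets some `I_{α+1}` while meeting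
`I_α` trivially, and there an operator of minimal finite rank yields a minimal projection.

Stability comes from the factor `ℕ`, which absorbs `𝓚(ℓ₂)` through a bijection `ℕ ≃ ℕ × ℕ`. For the
width, in a nondegenerate representation of `𝓚(ℓ₂(κ))` by compact operators on `ℓ₂(μ)` every
coordinate is hit by one of the `κ` diagonal matrix units, and each of these hits only countably
many coordinates.
-/

noncomputable section

namespace ScatteredCStar

open InnerProductSpace (rankOne)
open scoped CStarAlgebra TensorProduct

/-! ### Compact operators -/

section CompactOperators

variable {H : Type u} [NormedAddCommGroup H] [InnerProductSpace ℂ H]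

theorem isCompactOperator_rankOne (v w : H) : IsCompactOperator (rankOne ℂ v w) :=
  (isCompactOperator_of_locallyCompactSpace_dom (innerSL ℂ w)).clm_comp
    (ContinuousLinearMap.toSpanSingleton ℂ v)

theorem exists_norm_sub_starProjection_comp_le {T : H →L[ℂ] H} (hT : IsCompactOperator T)
    {ε : ℝ} (hε : 0 < ε) : ∃ (V : Submodule ℂ H) (_ : FiniteDimensional ℂ V),
      ‖T - V.starProjection ∘L T‖ ≤ ε := by
  obtain ⟨t, ht, hcover⟩ := Metric.totallyBounded_iff.1
    ((hT.isCompact_closure_image_closedBall (f := (T : H →ₗ[ℂ] H)) 1).totallyBounded.subset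
      subset_closure) ε hε
  have : FiniteDimensional ℂ (Submodule.span ℂ t) := .span_of_finite ℂ ht
  refine ⟨Submodule.span ℂ t, this,
    ContinuousLinearMap.opNorm_le_of_unit_norm hε.le fun x hx => ?_⟩
  have hx' := hcover (Set.mem_image_of_mem _ (by simpa using hx.le : x ∈ Metric.closedBall 0 1))
  simp only [Set.mem_iUnion, mem_ball_iff_norm, exists_prop] at hx'
  obtain ⟨y, hy, hxy⟩ := hx'
  calc ‖T x - (Submodule.span ℂ t).starProjection (T x)‖
      = ⨅ z : Submodule.span ℂ t, ‖T x - z‖ := Submodule.starProjection_minimal _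
    _ ≤ ‖T x - y‖ := ciInf_le ⟨0, Set.forall_mem_range.2 fun _ => norm_nonneg _⟩
        (⟨y, Submodule.subset_span hy⟩ : Submodule.span ℂ t)
    _ ≤ ε := hxy.le

theorem rankOne_polarization (v w : H) :
    (4 : ℂ) • rankOne ℂ v w = rankOne ℂ (v + w) (v + w) - rankOne ℂ (v - w) (v - w) +
      Complex.I • rankOne ℂ (v + Complex.I • w) (v + Complex.I • w) -
      Complex.I • rankOne ℂ (v - Complex.I • w) (v - Complex.I • w) := by
  ext x
  simp only [map_add, map_sub, map_smulₛₗ, Complex.conj_I, RingHom.id_apply,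
    add_apply, sub_apply, neg_apply, smul_apply, smul_add, smul_sub, smul_neg, neg_smul, smul_smul,
    Complex.I_mul_I]
  module

variable [CompleteSpace H]

instance isClosed_compactOps : IsClosed (compactOps H : Set (H →L[ℂ] H)) :=
  isClosed_setOfPred_isCompactOperator

theorem mem_of_forall_rankOne_mem {M : Submodule ℂ (H →L[ℂ] H)}
    (hM : IsClosed (M : Set (H →L[ℂ] H))) (h : ∀ v w, rankOne ℂ v w ∈ M) {T : H →L[ℂ] H}
    (hT : IsCompactOperator T) : T ∈ M := by
  refine hM.closure_subset (Metric.mem_closure_iff.2 fun ε hε => ?_)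
  obtain ⟨V, _, hV⟩ := exists_norm_sub_starProjection_comp_le hT (half_pos hε)
  refine ⟨V.starProjection ∘L T, ?_, by rw [dist_eq_norm]; linarith⟩
  rw [(stdOrthonormalBasis ℂ V).starProjection_eq_sum_rankOne,
    ContinuousLinearMap.finsetSum_comp]
  exact sum_mem fun i _ => by rw [InnerProductSpace.rankOne_comp]; exact h _ _

/-- The rank-one operator `v ⊗ w*` as an element of `𝓚(H)`. -/
def compactRankOne (v w : H) : compactOps H := ⟨rankOne ℂ v w, isCompactOperator_rankOne v w⟩

theorem mem_of_forall_compactRankOne_mem {M : Submodule ℂ (compactOps H)}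
    (hM : IsClosed (M : Set (compactOps H)))
    (h : ∀ v : H, ‖v‖ = 1 → compactRankOne v v ∈ M) (k : compactOps H) : k ∈ M := by
  let incl : compactOps H →ₗ[ℂ] H →L[ℂ] H :=
    (compactOps H).toNonUnitalSubalgebra.toSubmodule.subtype
  have hdiag (v : H) : rankOne ℂ v v ∈ M.map incl := by
    rcases eq_or_ne v 0 with rfl | hv
    · simp
    have hv' : (‖v‖ : ℂ) ≠ 0 := by simpa using hv
    have hunit : rankOne ℂ ((‖v‖⁻¹ : ℂ) • v) ((‖v‖⁻¹ : ℂ) • v) ∈ M.map incl :=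
      ⟨_, h _ (norm_smul_inv_norm hv), rfl⟩
    convert Submodule.smul_mem _ ((‖v‖ : ℂ) * ‖v‖) hunit using 1
    simp only [map_smulₛₗ, smul_apply, smul_smul, map_inv₀, Complex.conj_ofReal, RingHom.id_apply]
    field_simp
    simp
  have hrank (v w : H) : rankOne ℂ v w ∈ M.map incl := by
    rw [← Submodule.smul_mem_iff _ (by norm_num : (4 : ℂ) ≠ 0), rankOne_polarization]
    exact sub_mem (add_mem (sub_mem (hdiag _) (hdiag _)) (Submodule.smul_mem _ _ (hdiag _)))
      (Submodule.smul_mem _ _ (hdiag _))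
  obtain ⟨k', hk', hkk'⟩ := mem_of_forall_rankOne_mem
    (isClosed_compactOps.isClosedEmbedding_subtypeVal.isClosedMap _ hM) hrank k.2
  rwa [← Subtype.ext hkk']

variable {H' : Type v} [NormedAddCommGroup H'] [InnerProductSpace ℂ H'] [CompleteSpace H']

/-- The isomorphism `𝓚(H) ≃ 𝓚(H')` given by conjugation with a unitary `H ≃ H'`. -/
def compactOpsCongr (e : H ≃ₗᵢ[ℂ] H') : compactOps H ≃⋆ₐ[ℂ] compactOps H' where
  toFun k := ⟨e.conjStarAlgEquiv k, (k.2.comp_clm (e.symm : H' →L[ℂ] H)).clm_comp (e : H →L[ℂ] H')⟩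
  invFun k := ⟨e.conjStarAlgEquiv.symm k,
    (k.2.comp_clm (e : H →L[ℂ] H')).clm_comp (e.symm : H' →L[ℂ] H)⟩
  left_inv _ := Subtype.ext (e.conjStarAlgEquiv.symm_apply_apply _)
  right_inv _ := Subtype.ext (e.conjStarAlgEquiv.apply_symm_apply _)
  map_mul' _ _ := Subtype.ext (map_mul e.conjStarAlgEquiv _ _)
  map_add' _ _ := Subtype.ext (map_add e.conjStarAlgEquiv _ _)
  map_smul' _ _ := Subtype.ext (map_smul e.conjStarAlgEquiv _ _)
  map_star' _ := Subtype.ext (map_star e.conjStarAlgEquiv _)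

end CompactOperators

/-! ### The Hilbert space `ℓ₂(X)` -/

section EllTwo

variable {X : Type u} {Y : Type v}

/-- The standard orthonormal basis of `ℓ₂(X)`. -/
def stdBasis (X : Type u) : HilbertBasis X ℂ (EllTwo X) := .ofRepr (.refl ℂ _)

theorem inner_stdBasis_left (x : X) (f : EllTwo X) : inner ℂ (stdBasis X x) f = f x :=
  ((stdBasis X).repr_apply_apply f x).symm

theorem stdBasis_eq_single [DecidableEq X] (x : X) : stdBasis X x = lp.single 2 x (1 : ℂ) :=
  ((stdBasis X).repr_self x)

theorem stdBasis_apply [DecidableEq X] (x y : X) : stdBasis X x y = if y = x then 1 else 0 := by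
  simp [stdBasis_eq_single, Pi.single_apply]

theorem eq_top_of_stdBasis_mem {M : Submodule ℂ (EllTwo X)} (hM : IsClosed (M : Set (EllTwo X)))
    (h : ∀ x, stdBasis X x ∈ M) : M = ⊤ :=
  top_le_iff.1 ((stdBasis X).dense_span.ge.trans
    (Submodule.topologicalClosure_minimal _ (Submodule.span_le.2 (Set.range_subset_iff.2 h)) hM))

theorem clm_ext_stdBasis {F : Type*} [NormedAddCommGroup F] [NormedSpace ℂ F]
    {S T : EllTwo X →L[ℂ] F} (h : ∀ x, S (stdBasis X x) = T (stdBasis X x)) : S = T :=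
  ContinuousLinearMap.ext_on (Submodule.dense_iff_topologicalClosure_eq_top.2
    (stdBasis X).dense_span) (Set.forall_mem_range.2 h)

theorem clm_ext_matrix {S T : EllTwo X →L[ℂ] EllTwo Y}
    (h : ∀ x y, S (stdBasis X x) y = T (stdBasis X x) y) : S = T :=
  clm_ext_stdBasis fun x => lp.ext (funext (h x))

/-- The isometric isomorphism `ℓ₂(X) ≃ ℓ₂(Y)` induced by a bijection `X ≃ Y`. -/
def ellTwoCongr (e : X ≃ Y) : EllTwo X ≃ₗᵢ[ℂ] EllTwo Y :=
  (HilbertBasis.mk ((stdBasis Y).orthonormal.comp e e.injective)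
    (by rw [Set.range_comp, e.range_eq_univ, Set.image_univ, (stdBasis Y).dense_span])).repr.symm

/-- The matrix unit `e_{st}`, sending the `t`-th basis vector to the `s`-th one. -/
def matrixUnit (s t : X) : EllTwo X →L[ℂ] EllTwo X := rankOne ℂ (stdBasis X s) (stdBasis X t)

theorem matrixUnit_apply (s t : X) (f : EllTwo X) : matrixUnit s t f = f t • stdBasis X s := by
  rw [matrixUnit, InnerProductSpace.rankOne_apply, inner_stdBasis_left]

theorem isCompactOperator_matrixUnit (s t : X) : IsCompactOperator (matrixUnit s t) :=
  isCompactOperator_rankOne _ _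

theorem matrixUnit_mul_matrixUnit_self (r s t : X) :
    matrixUnit r s * matrixUnit s t = matrixUnit r t := by
  classical
  ext1 f
  simp [matrixUnit_apply, stdBasis_apply]

theorem mem_of_forall_matrixUnit_mem {M : Submodule ℂ (EllTwo X →L[ℂ] EllTwo X)}
    (hM : IsClosed (M : Set (EllTwo X →L[ℂ] EllTwo X))) (h : ∀ s t, matrixUnit s t ∈ M)
    {T : EllTwo X →L[ℂ] EllTwo X} (hT : IsCompactOperator T) : T ∈ M := by
  have hbasis (s : X) (w : EllTwo X) : rankOne ℂ (stdBasis X s) w ∈ M := by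
    let r : EllTwo X →L⋆[ℂ] EllTwo X →L[ℂ] EllTwo X := rankOne ℂ (stdBasis X s)
    have hs : M.comap r.toLinearMap = ⊤ :=
      eq_top_of_stdBasis_mem (hM.preimage r.continuous) (h s)
    exact hs.ge (Submodule.mem_top (x := w))
  refine mem_of_forall_rankOne_mem hM (fun v w => ?_) hT
  let r : EllTwo X →L[ℂ] EllTwo X →L[ℂ] EllTwo X := (rankOne ℂ).flip w
  have hw : M.comap r.toLinearMap = ⊤ :=
    eq_top_of_stdBasis_mem (hM.preimage r.continuous) fun s => hbasis s w
  exact hw.ge (Submodule.mem_top (x := v))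

end EllTwo

/-! ### Amplifications -/

section Amplification

variable {Z : Type w} {H : Type u} [NormedAddCommGroup H] [InnerProductSpace ℂ H] [CompleteSpace H]
  {E : Type v} [NormedAddCommGroup E] [InnerProductSpace ℂ E] [CompleteSpace E]
  {V : Z → H →ₗᵢ[ℂ] E}

/-- The operator on the Hilbert sum of copies of `H` acting as `T` in each copy. -/
def diagonal (Z : Type w) (H : Type u) [NormedAddCommGroup H] [InnerProductSpace ℂ H]
    [CompleteSpace H] :
    (H →L[ℂ] H) →⋆ₙₐ[ℂ] (lp (fun _ : Z => H) 2 →L[ℂ] lp (fun _ : Z => H) 2) where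
  toFun T := lp.mapCLM 2 (fun _ => T) (norm_nonneg T) fun _ => le_rfl
  map_smul' _ _ := rfl
  map_zero' := rfl
  map_add' _ _ := rfl
  map_mul' _ _ := rfl
  map_star' T := by
    refine (ContinuousLinearMap.eq_adjoint_iff _ _).2 fun f g => ?_
    simp [lp.inner_eq_tsum, ContinuousLinearMap.star_eq_adjoint,
      ContinuousLinearMap.adjoint_inner_left]

theorem diagonal_single [DecidableEq Z] (T : H →L[ℂ] H) (z : Z) (f : H) :
    diagonal Z H T (lp.single 2 z f) = lp.single 2 z (T f) := by
  ext z'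
  change T ((lp.single 2 z f : lp (fun _ : Z => H) 2) z') = _
  rcases eq_or_ne z' z with rfl | h
  · simp only [lp.coeFn_single, Pi.single_eq_same]
  · simp only [lp.coeFn_single, Pi.single_eq_of_ne h, map_zero]

/-- If `E` is the Hilbert sum of copies of `H`, the `*`-homomorphism `𝓑(H) → 𝓑(E)` letting an
operator act diagonally. -/
def diagonalOn (hV : IsHilbertSum ℂ (fun _ => H) V) : (H →L[ℂ] H) →⋆ₙₐ[ℂ] (E →L[ℂ] E) where
  toFun T := hV.linearIsometryEquiv.symm.conjStarAlgEquiv (diagonal Z H T)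
  map_smul' c T := hV.linearIsometryEquiv.symm.conjStarAlgEquiv.map_smul' c (diagonal Z H T)
  map_zero' := (hV.linearIsometryEquiv.symm.conjStarAlgEquiv.toRingEquiv).map_zero
  map_add' S T := hV.linearIsometryEquiv.symm.conjStarAlgEquiv.map_add' (diagonal Z H S)
    (diagonal Z H T)
  map_mul' S T := hV.linearIsometryEquiv.symm.conjStarAlgEquiv.map_mul' (diagonal Z H S)
    (diagonal Z H T)
  map_star' T := (congrArg _ (map_star (diagonal Z H) T)).trans
    (hV.linearIsometryEquiv.symm.conjStarAlgEquiv.map_star' (diagonal Z H T))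

theorem diagonalOn_apply (hV : IsHilbertSum ℂ (fun _ => H) V) (T : H →L[ℂ] H) (z : Z) (f : H) :
    diagonalOn hV T (V z f) = V z (T f) := by
  classical
  have hsymm (g : H) := hV.linearIsometryEquiv_symm_apply_single (i := z) g
  calc diagonalOn hV T (V z f)
      = hV.linearIsometryEquiv.symm (diagonal Z H T (hV.linearIsometryEquiv (V z f))) := rfl
    _ = V z (T f) := by
      rw [← hsymm, LinearIsometryEquiv.apply_symm_apply, diagonal_single, hsymm]

end Amplification

section Slices

variable {X : Type u} {Y : Type v} {Z : Type w}

/-- The isometry `ℓ₂(Y) → ℓ₂(X)` induced by an injection `Y → X`. -/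
def embed {f : Y → X} (hf : Function.Injective f) : EllTwo Y →ₗᵢ[ℂ] EllTwo X :=
  ((stdBasis X).orthonormal.comp f hf).orthogonalFamily.linearIsometry

theorem embed_stdBasis {f : Y → X} (hf : Function.Injective f) (y : Y) :
    embed hf (stdBasis Y y) = stdBasis X (f y) := by
  classical
  rw [stdBasis_eq_single y, embed, OrthogonalFamily.linearIsometry_apply_single,
    LinearIsometry.toSpanSingleton_apply, one_smul, Function.comp_apply]

theorem embed_apply {f : Y → X} (hf : Function.Injective f) (v : EllTwo Y) (y : Y) :
    embed hf v (f y) = v y := by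
  rw [← inner_stdBasis_left, ← embed_stdBasis hf, LinearIsometry.inner_map_map,
    inner_stdBasis_left]

theorem embed_apply_of_notMem_range {f : Y → X} (hf : Function.Injective f) (v : EllTwo Y)
    {x : X} (hx : x ∉ Set.range f) : embed hf v x = 0 := by
  classical
  let coord : EllTwo Y →ₗ[ℂ] ℂ := (innerSL ℂ (stdBasis X x)).toLinearMap ∘ₗ (embed hf).toLinearMap
  have hcoord (u : EllTwo Y) : coord u = embed hf u x := inner_stdBasis_left _ _
  have hker : LinearMap.ker coord = ⊤ := by
    refine eq_top_of_stdBasis_mem (isClosed_singleton.preimage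
      ((innerSL ℂ (stdBasis X x)).continuous.comp (embed hf).continuous)) fun y => ?_
    rw [LinearMap.mem_ker, hcoord, embed_stdBasis, stdBasis_apply,
      if_neg fun h => hx ⟨y, h.symm⟩]
  rw [← hcoord]
  exact hker.ge Submodule.mem_top

variable (e : X ≃ Y × Z)

/-- The copy of `ℓ₂(Y)` inside `ℓ₂(X) ≅ ℓ₂(Y) ⊗ ℓ₂(Z)` belonging to `z`. -/
def slice (z : Z) : EllTwo Y →ₗᵢ[ℂ] EllTwo X :=
  embed (e.symm.injective.comp (Prod.mk_left_injective z))

theorem slice_stdBasis (z : Z) (y : Y) : slice e z (stdBasis Y y) = stdBasis X (e.symm (y, z)) :=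
  embed_stdBasis _ y

theorem slice_apply [DecidableEq Z] (z z' : Z) (v : EllTwo Y) (y : Y) :
    slice e z v (e.symm (y, z')) = if z = z' then v y else 0 := by
  split_ifs with h
  · subst h
    exact embed_apply (e.symm.injective.comp (Prod.mk_left_injective z)) v y
  · refine embed_apply_of_notMem_range _ v ?_
    rintro ⟨y', hy'⟩
    exact h (congrArg Prod.snd (e.symm.injective hy'))

theorem adjoint_slice_apply (z : Z) (v : EllTwo X) (y : Y) :
    ContinuousLinearMap.adjoint (slice e z).toContinuousLinearMap v y = v (e.symm (y, z)) := by
  rw [← inner_stdBasis_left, ContinuousLinearMap.adjoint_inner_right]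
  exact (congrArg (inner ℂ · v) (slice_stdBasis e z y)).trans (inner_stdBasis_left _ _)

theorem isHilbertSum_slice : IsHilbertSum ℂ (fun _ : Z => EllTwo Y) (slice e) := by
  classical
  refine IsHilbertSum.mk (fun z z' hzz' v v' => ?_) ?_
  · rw [lp.inner_eq_tsum, ← tsum_zero (α := ℂ) (β := X)]
    refine tsum_congr fun x => ?_
    obtain ⟨⟨y, z''⟩, rfl⟩ := e.symm.surjective x
    rw [slice_apply, slice_apply]
    split_ifs with h h' <;> simp_all
  · refine (eq_top_of_stdBasis_mem (Submodule.isClosed_topologicalClosure _) fun x => ?_).ge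
    obtain ⟨⟨y, z⟩, rfl⟩ := e.symm.surjective x
    exact Submodule.le_topologicalClosure _
      (Submodule.mem_iSup_of_mem z ⟨stdBasis Y y, slice_stdBasis e z y⟩)

/-- The `*`-homomorphism `T ↦ T ⊗ 1` from `𝓑(ℓ₂(Y))` to `𝓑(ℓ₂(X))`, where `X` is identified with
`Y × Z` and hence `ℓ₂(X)` with `ℓ₂(Y) ⊗ ℓ₂(Z)`. -/
def amplify : (EllTwo Y →L[ℂ] EllTwo Y) →⋆ₙₐ[ℂ] (EllTwo X →L[ℂ] EllTwo X) :=
  diagonalOn (isHilbertSum_slice e)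

theorem amplify_slice (T : EllTwo Y →L[ℂ] EllTwo Y) (z : Z) (v : EllTwo Y) :
    amplify e T (slice e z v) = slice e z (T v) := diagonalOn_apply _ T z v

theorem amplify_stdBasis (T : EllTwo Y →L[ℂ] EllTwo Y) (y : Y) (z : Z) :
    amplify e T (stdBasis X (e.symm (y, z))) = slice e z (T (stdBasis Y y)) := by
  rw [← slice_stdBasis, amplify_slice]

theorem amplify_matrix [DecidableEq Z] (T : EllTwo Y →L[ℂ] EllTwo Y) (x x' : X) :
    amplify e T (stdBasis X x) x' =
      if (e x).2 = (e x').2 then T (stdBasis Y (e x).1) (e x').1 else 0 := by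
  obtain ⟨⟨y, z⟩, rfl⟩ := e.symm.surjective x
  obtain ⟨⟨y', z'⟩, rfl⟩ := e.symm.surjective x'
  simp only [amplify_stdBasis, slice_apply, Equiv.apply_symm_apply]

theorem exists_eq_amplify [DecidableEq Z] {S : EllTwo X →L[ℂ] EllTwo X} (z₀ : Z)
    (hS : ∀ y z y' z', S (stdBasis X (e.symm (y, z))) (e.symm (y', z')) =
      if z = z' then S (stdBasis X (e.symm (y, z₀))) (e.symm (y', z₀)) else 0) :
    ∃ T, S = amplify e T := by
  refine ⟨ContinuousLinearMap.adjoint (slice e z₀).toContinuousLinearMap ∘L S ∘L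
    (slice e z₀).toContinuousLinearMap, clm_ext_matrix fun x x' => ?_⟩
  obtain ⟨⟨y, z⟩, rfl⟩ := e.symm.surjective x
  obtain ⟨⟨y', z'⟩, rfl⟩ := e.symm.surjective x'
  rw [hS, amplify_matrix]
  simp only [Equiv.apply_symm_apply, ContinuousLinearMap.comp_apply, adjoint_slice_apply,
    LinearIsometry.coe_toContinuousLinearMap, slice_stdBasis]

end Slices

/-! ### Minimal projections -/

section MinimalProjections

variable {D : Type u} [NonUnitalCStarAlgebra D]

theorem exists_mul_mul_eq_self {h : D} (hsa : IsSelfAdjoint h) (h0 : h ≠ 0) :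
    ∃ c f : D, f ≠ 0 ∧ c * h * f = f := by
  obtain ⟨δ, hδ, hδh⟩ := exists_between (norm_pos_iff.2 h0)
  let f (x : ℝ) : ℝ := max (|x| - δ) 0
  let c (x : ℝ) : ℝ := x / max (x ^ 2) (δ ^ 2)
  have hf : Continuous f := by fun_prop
  have hc : Continuous c := continuous_id.div (by fun_prop) fun x =>
    (lt_max_of_lt_right (by positivity)).ne'
  have hf0 : f 0 = 0 := by simp [f, hδ.le]
  have hc0 : c 0 = 0 := by simp [c]
  have hcf (x : ℝ) : c x * x * f x = f x := by
    rcases le_total |x| δ with hx | hx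
    · simp [f, hx]
    have hx0 : x ≠ 0 := abs_pos.1 (hδ.trans_le hx)
    have hcx : c x * x = 1 := by
      simp only [c, max_eq_left (sq_le_sq.2 ((abs_of_pos hδ).trans_le hx))]
      field_simp
    rw [hcx, one_mul]
  refine ⟨cfcₙ c h, cfcₙ f h, fun hfh => ?_, ?_⟩
  · have hle : ‖cfcₙ (fun x : ℝ => x) h‖ ≤ δ := norm_cfcₙ_le fun x hx => by
      have hfx : f x = 0 := (cfcₙ_eq_cfcₙ_iff_eqOn hsa (hf := hf.continuousOn) (hf0 := hf0)
        (g := 0)).1 (hfh.trans (cfcₙ_zero ℝ h).symm) hx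
      exact sub_nonpos.1 (max_eq_right_iff.1 hfx)
    rw [cfcₙ_id' ℝ h] at hle
    exact hle.not_gt hδh
  · calc cfcₙ c h * h * cfcₙ f h
        = cfcₙ (fun x => c x * x * f x) h := by
          rw [cfcₙ_mul (fun x => c x * x) f h (by fun_prop) (by simp) hf.continuousOn hf0,
            cfcₙ_mul c (fun x => x) h hc.continuousOn hc0, cfcₙ_id' ℝ h]
      _ = cfcₙ f h := congrArg (cfcₙ · h) (funext hcf)

variable {H : Type v} [NormedAddCommGroup H] [InnerProductSpace ℂ H] [CompleteSpace H]
  {π : D →⋆ₙₐ[ℂ] (H →L[ℂ] H)}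

theorem range_map_mul_le (π : D →⋆ₙₐ[ℂ] (H →L[ℂ] H)) (x y : D) :
    (π (x * y)).range ≤ (π x).range := by
  rw [map_mul]
  exact LinearMap.range_comp_le_range _ _

theorem exists_finiteDimensional_range {d : D} (hd : d ≠ 0) (hc : IsCompactOperator (π d)) :
    ∃ x : D, x ≠ 0 ∧ FiniteDimensional ℂ (π x).range := by
  obtain ⟨c, f, hf0, hcf⟩ := exists_mul_mul_eq_self (IsSelfAdjoint.star_mul_self d)
    (CStarRing.star_mul_self_ne_zero_iff d |>.2 hd)
  have hcomp : IsCompactOperator (π (c * (star d * d))) := by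
    rw [← mul_assoc, map_mul]
    exact hc.clm_comp _
  have := ContinuousLinearMap.finite_dimensional_eigenspace hcomp 1 one_ne_zero
  refine ⟨f, hf0, Submodule.finiteDimensional_of_le
    (S₂ := Module.End.eigenspace (π (c * (star d * d))).toLinearMap 1) ?_⟩
  rintro _ ⟨v, rfl⟩
  rw [Module.End.mem_eigenspace_iff, one_smul]
  exact congr($((map_mul π _ _).symm.trans (congrArg π hcf)) v)

/-- `x` is nonzero and `π x` has the least finite rank among all nonzero elements of `D`. -/
def HasMinimalRank (π : D →⋆ₙₐ[ℂ] (H →L[ℂ] H)) (x : D) : Prop :=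
  MinimalFor (fun y => y ≠ 0 ∧ FiniteDimensional ℂ (π y).range)
    (fun y => Module.finrank ℂ (π y).range) x

theorem HasMinimalRank.of_range_le {x y : D} (hx : HasMinimalRank π x) (hy : y ≠ 0)
    (hyx : (π y).range ≤ (π x).range) : HasMinimalRank π y := by
  have := hx.prop.2
  exact ⟨⟨hy, Submodule.finiteDimensional_of_le hyx⟩, fun z hz hzy =>
    (Submodule.finrank_mono hyx).trans (hx.le_of_le hz (hzy.trans (Submodule.finrank_mono hyx)))⟩

theorem HasMinimalRank.exists_mul_eq_smul (hπ : Function.Injective π) {x : D}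
    (hx : HasMinimalRank π x) {a : D} (ha : (π (a * x)).range ≤ (π x).range) :
    ∃ l : ℂ, a * x = l • x := by
  obtain ⟨hx0, _⟩ := hx.prop
  have hmaps : ∀ v ∈ (π x).range, π a v ∈ (π x).range := by
    rintro _ ⟨v, rfl⟩
    exact ha ⟨v, congr($(map_mul π a x) v)⟩
  let f : Module.End ℂ (π x).range := (π a).toLinearMap.restrict hmaps
  have : Nontrivial (π x).range := by
    rw [Submodule.nontrivial_iff_ne_bot, Ne, LinearMap.range_eq_bot]
    exact fun h => hx0 (hπ ((ContinuousLinearMap.coe_injective h).trans (map_zero π).symm))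
  obtain ⟨l, hl⟩ := Module.End.exists_eigenvalue f
  obtain ⟨u, hu⟩ := hl.exists_hasEigenvector
  refine ⟨l, by_contra fun hne => ?_⟩
  have hval (v : H) : π (a * x - l • x) v = (f - algebraMap ℂ _ l) ⟨π x v, v, rfl⟩ := by
    rw [map_sub, map_mul, map_smul]
    rfl
  have hle : (π (a * x - l • x)).range ≤ (π x).range := by
    rintro _ ⟨v, rfl⟩
    exact (hval v).symm ▸ Subtype.property _
  have hrange : (π (a * x - l • x)).range = (π x).range := Submodule.eq_of_le_of_finrank_le hle
    (hx.le_of_le ⟨sub_ne_zero.2 hne, Submodule.finiteDimensional_of_le hle⟩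
      (Submodule.finrank_mono hle))
  have hsurj : Function.Surjective (f - algebraMap ℂ (Module.End ℂ (π x).range) l) := by
    rintro ⟨w, hw⟩
    obtain ⟨v, rfl⟩ := hrange.ge hw
    exact ⟨⟨π x v, v, rfl⟩, Subtype.ext (hval v).symm⟩
  refine hu.2 (LinearMap.injective_iff_surjective.2 hsurj ?_)
  rw [map_zero, LinearMap.sub_apply, hu.apply_eq_smul, Module.algebraMap_end_apply, sub_self]

theorem HasMinimalRank.exists_isStarProjection (hπ : Function.Injective π) {x : D}
    (hx : HasMinimalRank π x) : ∃ p : D, IsStarProjection p ∧ HasMinimalRank π p := by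
  set y := x * star x
  have hy0 : y ≠ 0 := CStarRing.mul_star_self_ne_zero_iff x |>.2 hx.prop.1
  have hy : HasMinimalRank π y := hx.of_range_le hy0 (range_map_mul_le π _ _)
  have hystar : star y = y := (IsSelfAdjoint.mul_star_self x).star_eq
  obtain ⟨l, hl⟩ := hy.exists_mul_eq_smul hπ (range_map_mul_le π y y)
  have hlstar : star l = l := smul_left_injective ℂ hy0 (by
    dsimp only
    rw [← hl, ← hystar, ← star_smul, ← hl, star_mul, hystar])
  have hl0 : l ≠ 0 := by
    rintro rfl
    rw [zero_smul] at hl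
    exact CStarRing.star_mul_self_ne_zero_iff y |>.2 hy0 (hystar.symm ▸ hl)
  refine ⟨l⁻¹ • y, ⟨?_, ?_⟩, hy.of_range_le (smul_ne_zero (inv_ne_zero hl0) hy0) ?_⟩
  · rw [IsIdempotentElem, smul_mul_smul_comm, hl, smul_smul, inv_mul_cancel_right₀ hl0]
  · rw [IsSelfAdjoint, star_smul, star_inv₀, hlstar, hystar]
  · rw [map_smul]
    exact (LinearMap.range_smul (π y).toLinearMap _ (inv_ne_zero hl0)).le

theorem exists_isMinimalProjection (hπ : Function.Injective π) {d : D} (hd : d ≠ 0)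
    (hc : IsCompactOperator (π d)) : ∃ p : D, IsMinimalProjection p := by
  obtain ⟨x, hx⟩ := exists_minimalFor_of_wellFoundedLT _
    (fun y => Module.finrank ℂ (π y).range) (exists_finiteDimensional_range hd hc)
  obtain ⟨p, hp, hprank⟩ := HasMinimalRank.exists_isStarProjection hπ hx
  refine ⟨p, hp, hprank.prop.1, fun a => hprank.exists_mul_eq_smul hπ ?_⟩
  rw [mul_assoc]
  exact range_map_mul_le π _ _

end MinimalProjections

/-! ### Algebras of operators containing the compact operators -/

section AtomIdeal

variable {Q : Type u} [NonUnitalRing Q] [StarRing Q] [Module ℂ Q] {H : Type v}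
  [NormedAddCommGroup H] [InnerProductSpace ℂ H] [CompleteSpace H]
  {φ : Q →⋆ₙₐ[ℂ] (H →L[ℂ] H)} {σ : compactOps H →⋆ₙₐ[ℂ] Q}

theorem isMinimalProjection_of_map_eq_rankOne (hφ : Function.Injective φ) {q : Q} {v : H}
    (hv : ‖v‖ = 1) (hq : φ q = rankOne ℂ v v) : IsMinimalProjection q := by
  have hproj := InnerProductSpace.isStarProjection_rankOne_self (𝕜 := ℂ) hv
  rw [← hq] at hproj
  refine ⟨⟨hφ ?_, hφ ?_⟩, ?_, fun a => ⟨inner ℂ v (φ a v), hφ ?_⟩⟩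
  · rw [map_mul, hproj.isIdempotentElem]
  · rw [map_star, hproj.isSelfAdjoint]
  · rintro rfl
    have hv0 : v ≠ 0 := norm_ne_zero_iff.1 (hv.symm ▸ one_ne_zero)
    exact InnerProductSpace.rankOne_ne_zero hv0 hv0 (hq.symm.trans (map_zero φ))
  · rw [map_mul, map_mul, map_smul, hq, ContinuousLinearMap.mul_def, ContinuousLinearMap.mul_def,
      ContinuousLinearMap.comp_assoc, InnerProductSpace.comp_rankOne,
      InnerProductSpace.rankOne_comp_rankOne]

theorem IsMinimalProjection.isCompactOperator_map (hφ : Function.Injective φ)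
    (hσ : ∀ k, φ (σ k) = k) {p : Q} (hp : IsMinimalProjection p) : IsCompactOperator (φ p) := by
  have hp0 : φ p ≠ 0 := fun h => hp.ne_zero (hφ (h.trans (map_zero φ).symm))
  obtain ⟨v, hv⟩ : ∃ v, φ p v ≠ 0 := by
    by_contra! h
    exact hp0 (ContinuousLinearMap.ext h)
  obtain ⟨c, hc⟩ := hp.corner (σ (compactRankOne v v))
  have hrank : rankOne ℂ (φ p v) (φ p v) = c • φ p := by
    rw [← map_smul, ← hc, map_mul, map_mul, hσ, compactRankOne, ContinuousLinearMap.mul_def,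
      ContinuousLinearMap.mul_def, InnerProductSpace.comp_rankOne,
      InnerProductSpace.rankOne_comp, ← ContinuousLinearMap.star_eq_adjoint, ← map_star,
      hp.isStarProjection.isSelfAdjoint.star_eq]
  have hc0 : c ≠ 0 := by
    rintro rfl
    simp [hv] at hrank
  rw [← inv_smul_smul₀ hc0 (φ p), ← hrank]
  exact (isCompactOperator_rankOne _ _).smul c⁻¹

theorem atomIdeal_eq_setOf_isCompactOperator [IsScalarTower ℂ Q Q] [SMulCommClass ℂ Q Q]
    [StarModule ℂ Q] [TopologicalSpace Q] (hφ : Function.Injective φ) (hφc : Continuous φ)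
    (hσc : Continuous σ) (hσ : ∀ k, φ (σ k) = k) :
    atomIdeal Q = {q | IsCompactOperator (φ q)} := by
  refine (closure_minimal ?_ (isClosed_compactOps.preimage hφc)).antisymm fun q hq => ?_
  · exact NonUnitalStarAlgebra.adjoin_le (S := (compactOps H).comap φ) fun p hp =>
      hp.isCompactOperator_map hφ hσ
  · let M : Submodule ℂ (compactOps H) := ((NonUnitalStarAlgebra.adjoin ℂ
      {p : Q | IsMinimalProjection p}).comap σ).toNonUnitalSubalgebra.toSubmodule
    have hM (k : compactOps H) : k ∈ M.topologicalClosure :=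
      mem_of_forall_compactRankOne_mem M.isClosed_topologicalClosure (fun v hv =>
        M.le_topologicalClosure (NonUnitalStarAlgebra.subset_adjoin ℂ _
          (isMinimalProjection_of_map_eq_rankOne hφ hv (hσ _)))) k
    rw [hφ (hσ ⟨φ q, hq⟩).symm]
    exact map_mem_closure hσc (hM _) fun k hk => hk

end AtomIdeal

namespace ClosedIdeal

variable {A : Type u} [NonUnitalCStarAlgebra A] (I : ClosedIdeal A)

theorem continuous_cls : Continuous I.cls := I.sub.continuous_mkQ

/-- The `*`-homomorphism on `A / I` induced by one on `A` that vanishes on `I`. -/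
def liftHom {B : Type v} [NonUnitalRing B] [Star B] [Module ℂ B] (f : A →⋆ₙₐ[ℂ] B)
    (hf : ∀ a ∈ I.carrier, f a = 0) : I.QuotientAlg →⋆ₙₐ[ℂ] B where
  toFun := I.sub.liftQ (f : A →ₗ[ℂ] B) hf
  map_smul' := map_smul (I.sub.liftQ (f : A →ₗ[ℂ] B) hf)
  map_add' := map_add (I.sub.liftQ (f : A →ₗ[ℂ] B) hf)
  map_zero' := map_zero f
  map_mul' x y := by
    obtain ⟨a, rfl⟩ := I.cls_surjective x
    obtain ⟨b, rfl⟩ := I.cls_surjective y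
    exact map_mul f a b
  map_star' x := by
    obtain ⟨a, rfl⟩ := I.cls_surjective x
    exact map_star f a

theorem continuous_liftHom {B : Type v} [NonUnitalCStarAlgebra B] (f : A →⋆ₙₐ[ℂ] B)
    (hf : ∀ a ∈ I.carrier, f a = 0) : Continuous (I.liftHom f hf) :=
  (Submodule.isQuotientMap_mkQ (S := I.sub)).continuous_iff.2 (map_continuous f)

end ClosedIdeal

/-- A continuous increasing chain of closed ideals `I_α`, `α ≤ θ`, from `0` to `A`, such that
`A / I_α` acts faithfully on a Hilbert space `H α` with `I_{α+1} / I_α` acting by the compact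
operators; `sec` splits the resulting extension of `𝓚(H α)` by `I_α`. Only the values of `ideal`
at ordinals `≤ θ` matter. -/
structure CompositionSeries (A : Type u) [NonUnitalCStarAlgebra A] (θ : Ordinal.{u})
    (H : Set.Iio θ → Type v) [∀ α, NormedAddCommGroup (H α)] [∀ α, InnerProductSpace ℂ (H α)]
    [∀ α, CompleteSpace (H α)] where
  ideal : Ordinal.{u} → ClosedIdeal A
  ideal_zero : (ideal 0).carrier = {0}
  mono : ∀ α β, α ≤ β → β ≤ θ → (ideal α).carrier ⊆ (ideal β).carrier
  limit : ∀ γ, γ ≤ θ → Order.IsSuccLimit γ →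
    (ideal γ).carrier = closure (⋃ α ∈ Set.Iio γ, (ideal α).carrier)
  ideal_top : (ideal θ).carrier = Set.univ
  rep : ∀ α : Set.Iio θ, A →⋆ₙₐ[ℂ] (H α →L[ℂ] H α)
  rep_eq_zero_iff : ∀ α a, rep α a = 0 ↔ a ∈ (ideal α).carrier
  isCompactOperator_rep_iff : ∀ α a,
    IsCompactOperator (rep α a) ↔ a ∈ (ideal (Order.succ (α : Ordinal))).carrier
  sec : ∀ α, compactOps (H α) →⋆ₙₐ[ℂ] A
  rep_sec : ∀ α k, rep α (sec α k) = k

namespace CompositionSeries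

variable {A : Type u} [NonUnitalCStarAlgebra A] {θ : Ordinal.{u}} {H : Set.Iio θ → Type v}
  [∀ α, NormedAddCommGroup (H α)] [∀ α, InnerProductSpace ℂ (H α)] [∀ α, CompleteSpace (H α)]
  (C : CompositionSeries A θ H) (α : Set.Iio θ)

/-- The faithful representation of `A / I_α` induced by the `α`-th representation. -/
def quotRep : (C.ideal α).QuotientAlg →⋆ₙₐ[ℂ] (H α →L[ℂ] H α) :=
  (C.ideal α).liftHom (C.rep α) fun a => (C.rep_eq_zero_iff α a).2

theorem quotRep_injective : Function.Injective (C.quotRep α) := by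
  refine (injective_iff_map_eq_zero _).2 fun x hx => ?_
  obtain ⟨a, rfl⟩ := (C.ideal α).cls_surjective x
  exact (C.ideal α).cls_eq_cls_iff.2 ((sub_zero a).symm ▸ (C.rep_eq_zero_iff α a).1 hx)

/-- The copy of the compact operators inside `A / I_α`. -/
def quotSec : compactOps (H α) →⋆ₙₐ[ℂ] (C.ideal α).QuotientAlg :=
  (C.ideal α).mkHom.comp (C.sec α)

theorem quotRep_quotSec (k : compactOps (H α)) : C.quotRep α (C.quotSec α k) = k :=
  C.rep_sec α k

theorem cls_image_succ : (C.ideal α).cls '' (C.ideal (Order.succ (α : Ordinal))).carrier =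
    {q | IsCompactOperator (C.quotRep α q)} := by
  refine Set.Subset.antisymm ?_ fun q hq => ?_
  · rintro _ ⟨a, ha, rfl⟩
    exact (C.isCompactOperator_rep_iff α a).2 ha
  · obtain ⟨a, rfl⟩ := (C.ideal α).cls_surjective q
    exact ⟨a, (C.isCompactOperator_rep_iff α a).1 hq, rfl⟩

theorem atomIdeal_quotientAlg : atomIdeal (C.ideal α).QuotientAlg =
    (C.ideal α).cls '' (C.ideal (Order.succ (α : Ordinal))).carrier := by
  rw [cls_image_succ]
  exact atomIdeal_eq_setOf_isCompactOperator (C.quotRep_injective α)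
    ((C.ideal α).continuous_liftHom _ _)
    ((C.ideal α).continuous_cls.comp (map_continuous (C.sec α))) (C.quotRep_quotSec α)

/-- A composition series with nonzero layers is the Cantor–Bendixson sequence. -/
def cantorBendixson [∀ α, Nontrivial (H α)] : CantorBendixson A where
  height := θ
  ideal := C.ideal
  ideal_zero := C.ideal_zero
  mono := C.mono
  limit := C.limit
  succ α hα := C.atomIdeal_quotientAlg ⟨α, hα⟩
  ideal_height := C.ideal_top
  ne_univ α hα h := by
    obtain ⟨v, hv⟩ := exists_ne (0 : H ⟨α, hα⟩)
    have hmem : C.sec ⟨α, hα⟩ (compactRankOne v v) ∈ (C.ideal α).carrier := h ▸ Set.mem_univ _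
    rw [← C.rep_eq_zero_iff ⟨α, hα⟩, C.rep_sec] at hmem
    exact InnerProductSpace.rankOne_ne_zero hv hv hmem

/-- The layers of the Cantor–Bendixson sequence are the algebras of compact operators. -/
def layerEquiv [∀ α, Nontrivial (H α)] : C.cantorBendixson.layer α ≃⋆ₐ[ℂ] compactOps (H α) where
  toFun q := ⟨C.quotRep α q.1, (C.cls_image_succ α).subset q.2⟩
  invFun k := ⟨C.quotSec α k, (C.cls_image_succ α).superset
    (congrArg (· ∈ compactOps (H α)) (C.quotRep_quotSec α k) ▸ k.2)⟩
  left_inv _ := Subtype.ext (C.quotRep_injective α (C.quotRep_quotSec α _))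
  right_inv k := Subtype.ext (C.quotRep_quotSec α k)
  map_mul' x y := Subtype.ext (map_mul (C.quotRep α) x.1 y.1)
  map_add' x y := Subtype.ext (map_add (C.quotRep α) x.1 y.1)
  map_star' x := Subtype.ext (map_star (C.quotRep α) x.1)
  map_smul' c x := Subtype.ext (map_smul (C.quotRep α) c x.1)

variable {α} in
theorem injective_rep_comp_subtype {D : NonUnitalStarSubalgebra ℂ A}
    (hD : ∀ d ∈ D, d ∈ (C.ideal α).carrier → d = 0) :
    Function.Injective ((C.rep α).comp (NonUnitalStarSubalgebraClass.subtype D)) :=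
  (injective_iff_map_eq_zero _).2 fun x hx =>
    Subtype.ext (hD x x.2 ((C.rep_eq_zero_iff α _).1 hx))

theorem eq_zero_of_mem_closure_iUnion_ideal {D : NonUnitalStarSubalgebra ℂ A}
    (hD : IsClosed (D : Set A)) {γ : Ordinal.{u}} (hγ : γ ≤ θ)
    (hinj : ∀ β < γ, ∀ d ∈ D, d ∈ (C.ideal β).carrier → d = 0) {d : A} (hd : d ∈ D)
    (hdγ : d ∈ closure (⋃ α ∈ Set.Iio γ, (C.ideal α).carrier)) : d = 0 := by
  by_contra hd0
  obtain ⟨b, hb, hdb⟩ := Metric.mem_closure_iff.1 hdγ ‖d‖ (norm_pos_iff.2 hd0)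
  simp only [Set.mem_iUnion, Set.mem_Iio, exists_prop] at hb
  obtain ⟨β, hβ, hb⟩ := hb
  let β' : Set.Iio θ := ⟨β, hβ.trans_le hγ⟩
  refine hdb.not_ge ?_
  calc ‖d‖ = ‖C.rep β' d‖ := (NonUnitalStarAlgHom.norm_map _
        (C.injective_rep_comp_subtype (α := β') (hinj β hβ)) ⟨d, hd⟩).symm
    _ = ‖C.rep β' (d - b)‖ := by rw [map_sub, (C.rep_eq_zero_iff β' b).2 hb, sub_zero]
    _ ≤ dist d b := (NonUnitalStarAlgHom.norm_apply_le _ _).trans_eq (dist_eq_norm d b).symm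

theorem exists_forall_mem_ideal_eq_zero {D : NonUnitalStarSubalgebra ℂ A}
    (hD : IsClosed (D : Set A)) (hD0 : D ≠ ⊥) :
    ∃ α : Set.Iio θ, (∀ d ∈ D, d ∈ (C.ideal α).carrier → d = 0) ∧
      ∃ d ∈ D, d ≠ 0 ∧ d ∈ (C.ideal (Order.succ (α : Ordinal))).carrier := by
  obtain ⟨d₀, hd₀, hd₀0⟩ : ∃ d ∈ D, d ≠ 0 := by
    by_contra! h
    exact hD0 (eq_bot_iff.2 fun d hd => NonUnitalStarAlgebra.mem_bot.2 (h d hd))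
  obtain ⟨γ, ⟨hγ, d, hd, hd0, hdγ⟩, hmin⟩ := exists_minimal_of_wellFoundedLT
    (fun γ => γ ≤ θ ∧ ∃ d ∈ D, d ≠ 0 ∧ d ∈ (C.ideal γ).carrier)
    ⟨θ, le_rfl, d₀, hd₀, hd₀0, C.ideal_top ▸ Set.mem_univ d₀⟩
  have hinj (β : Ordinal.{u}) (hβ : β < γ) (b : A) (hb : b ∈ D) (hbβ : b ∈ (C.ideal β).carrier) :
      b = 0 :=
    by_contra fun hb0 => hβ.not_ge (hmin ⟨hβ.le.trans hγ, b, hb, hb0, hbβ⟩ hβ.le)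
  rcases Ordinal.zero_or_succ_or_isSuccLimit γ with rfl | ⟨β, rfl⟩ | hlim
  · exact absurd (C.ideal_zero.subset hdγ) hd0
  · exact ⟨⟨β, (Order.lt_succ β).trans_le hγ⟩, hinj β (Order.lt_succ β), d, hd, hd0, hdγ⟩
  · rw [C.limit γ hγ hlim] at hdγ
    exact absurd (C.eq_zero_of_mem_closure_iUnion_ideal hD hγ hinj hd hdγ) hd0

theorem isScattered (C : CompositionSeries A θ H) : IsScattered A := by
  intro D hD hD0
  have : IsClosed (D : Set A) := hD
  obtain ⟨α, hinj, d, hd, hd0, hdα⟩ := C.exists_forall_mem_ideal_eq_zero hD hD0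
  obtain ⟨p, hp⟩ := exists_isMinimalProjection (C.injective_rep_comp_subtype hinj) (d := ⟨d, hd⟩)
    (fun h => hd0 (congrArg Subtype.val h)) ((C.isCompactOperator_rep_iff α d).2 hdα)
  exact ⟨p, subset_closure (NonUnitalStarAlgebra.subset_adjoin ℂ _ hp), hp.ne_zero⟩

end CompositionSeries

/-! ### Width -/

section Width

open Cardinal

theorem countable_setOf_apply_ne_zero {X : Type u} (f : EllTwo X) : {x | f x ≠ 0}.Countable :=
  (lp.memℓp f).summable (by norm_num) |>.countable_support.mono fun x hx => by simpa using hx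

theorem isSeparable_range_of_isCompactOperator {H : Type u} [NormedAddCommGroup H]
    [InnerProductSpace ℂ H] {T : H →L[ℂ] H} (hT : IsCompactOperator T) :
    TopologicalSpace.IsSeparable (Set.range T) := by
  have hball (n : ℕ) : TopologicalSpace.IsSeparable (T '' Metric.closedBall 0 n) :=
    ((hT.isCompact_closure_image_closedBall (f := (T : H →ₗ[ℂ] H)) n).isSeparable).mono
      subset_closure
  refine (TopologicalSpace.IsSeparable.iUnion hball).mono ?_
  rw [← Set.image_iUnion, Metric.iUnion_closedBall_nat, Set.image_univ]

theorem countable_setOf_exists_apply_ne_zero {X : Type u} {T : EllTwo X →L[ℂ] EllTwo X}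
    (hT : IsCompactOperator T) : {x | ∃ f, T f x ≠ 0}.Countable := by
  obtain ⟨c, hc, hTc⟩ := isSeparable_range_of_isCompactOperator hT
  refine (hc.biUnion fun f _ => countable_setOf_apply_ne_zero f).mono fun x hx => ?_
  obtain ⟨f, hf⟩ := hx
  by_contra! hx
  simp only [Set.mem_iUnion, Set.mem_ofPred_eq, not_exists, not_not] at hx
  have hclosed : IsClosed {g : EllTwo X | inner ℂ (stdBasis X x) g = 0} :=
    isClosed_eq (innerSL ℂ (stdBasis X x)).continuous continuous_const
  have hzero : inner ℂ (stdBasis X x) (T f) = 0 := closure_minimal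
    (fun g hg => (inner_stdBasis_left x g).trans (hx g hg)) hclosed (hTc ⟨f, rfl⟩)
  exact hf ((inner_stdBasis_left x _).symm.trans hzero)

/-- The matrix unit `e_{st}` as an element of `𝓚(ℓ₂(X))`. -/
def compactMatrixUnit {X : Type u} (s t : X) : compactOps (EllTwo X) :=
  ⟨matrixUnit s t, isCompactOperator_matrixUnit s t⟩

theorem mem_of_forall_compactMatrixUnit_mem {X : Type u}
    {M : Submodule ℂ (compactOps (EllTwo X))} (hM : IsClosed (M : Set (compactOps (EllTwo X))))
    (h : ∀ s t, compactMatrixUnit s t ∈ M) (k : compactOps (EllTwo X)) : k ∈ M := by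
  let incl : compactOps (EllTwo X) →ₗ[ℂ] EllTwo X →L[ℂ] EllTwo X :=
    (compactOps (EllTwo X)).toNonUnitalSubalgebra.toSubmodule.subtype
  obtain ⟨k', hk', hkk'⟩ := mem_of_forall_matrixUnit_mem (M := M.map incl)
    (isClosed_compactOps.isClosedEmbedding_subtypeVal.isClosedMap _ hM)
    (fun s t => ⟨_, h s t, rfl⟩) k.2
  rwa [← Subtype.ext hkk']

theorem exists_map_compactMatrixUnit_apply_ne_zero {X : Type u} {Y : Type v}
    (π : compactOps (EllTwo X) →⋆ₙₐ[ℂ] (EllTwo Y →L[ℂ] EllTwo Y))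
    (hπ : (Submodule.span ℂ {f | ∃ k g, π k g = f}).topologicalClosure = ⊤) (y : Y) :
    ∃ s f, π (compactMatrixUnit s s) f y ≠ 0 := by
  by_contra! h
  let coord : EllTwo Y →L[ℂ] ℂ := innerSL ℂ (stdBasis Y y)
  have hcoord (g : EllTwo Y) : coord g = g y := inner_stdBasis_left y g
  let M (g : EllTwo Y) : Submodule ℂ (compactOps (EllTwo X)) :=
    LinearMap.ker (coord.toLinearMap ∘ₗ (ContinuousLinearMap.apply ℂ _ g).toLinearMap ∘ₗ
      LinearMapClass.linearMap π)
  have hM (g : EllTwo Y) : IsClosed (M g : Set (compactOps (EllTwo X))) :=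
    isClosed_singleton.preimage (coord.continuous.comp
      ((ContinuousLinearMap.apply ℂ _ g).continuous.comp (map_continuous π)))
  have hunit (g : EllTwo Y) (s t : X) : compactMatrixUnit s t ∈ M g := by
    have hst : compactMatrixUnit s t = compactMatrixUnit s s * compactMatrixUnit s t :=
      Subtype.ext (matrixUnit_mul_matrixUnit_self s s t).symm
    change coord (π (compactMatrixUnit s t) g) = 0
    rw [hst, map_mul, hcoord]
    exact h s _
  have hker : (Submodule.span ℂ {f | ∃ k g, π k g = f}).topologicalClosure ≤
      LinearMap.ker coord.toLinearMap := by
    refine Submodule.topologicalClosure_minimal _ (Submodule.span_le.2 ?_)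
      (isClosed_singleton.preimage coord.continuous)
    rintro _ ⟨k, g, rfl⟩
    exact mem_of_forall_compactMatrixUnit_mem (hM g) (hunit g) k
  have hone : coord (stdBasis Y y) = 0 := hker (hπ.ge (Submodule.mem_top))
  classical
  rw [hcoord, stdBasis_apply, if_pos rfl] at hone
  exact one_ne_zero hone

theorem mk_le_of_representation {X Y : Type u} [Infinite X]
    (π : compactOps (EllTwo X) →⋆ₙₐ[ℂ] (EllTwo Y →L[ℂ] EllTwo Y))
    (hcomp : ∀ k, IsCompactOperator (π k))
    (hπ : (Submodule.span ℂ {f | ∃ k g, π k g = f}).topologicalClosure = ⊤) : #Y ≤ #X := by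
  let supp (s : X) : Set Y := {y | ∃ f, π (compactMatrixUnit s s) f y ≠ 0}
  have hcover : ⋃ s, supp s = Set.univ := Set.eq_univ_of_forall fun y =>
    Set.mem_iUnion.2 (exists_map_compactMatrixUnit_apply_ne_zero π hπ y)
  calc #Y = #(⋃ s, supp s) := by rw [hcover, mk_univ]
    _ ≤ sum fun s => #(supp s) := mk_iUnion_le_sum_mk
    _ ≤ sum fun _ : X => ℵ₀ :=
      sum_le_sum _ _ fun s => (countable_setOf_exists_apply_ne_zero (hcomp _)).le_aleph0
    _ = #X * ℵ₀ := by simp only [sum_const, lift_id]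
    _ = #X := mul_eq_left (aleph0_le_mk X) (aleph0_le_mk X) aleph0_ne_zero

theorem mk_le_of_isNondegenerateSubalgebraOfCompacts {L : Type v} [NonUnitalRing L] [StarRing L]
    [Module ℂ L] {X Y : Type u} [Infinite X] (e : L ≃⋆ₐ[ℂ] compactOps (EllTwo X))
    (h : CantorBendixson.IsNondegenerateSubalgebraOfCompacts L Y) : #Y ≤ #X := by
  obtain ⟨B, hB, -, hspan, ⟨e'⟩⟩ := h
  let φ : compactOps (EllTwo X) ≃⋆ₐ[ℂ] B := e.symm.trans e'
  refine mk_le_of_representation ((NonUnitalStarSubalgebraClass.subtype B).comp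
    (φ : compactOps (EllTwo X) →⋆ₙₐ[ℂ] B)) (fun k => hB (φ k).2) ?_
  rw [← hspan]
  congr 2
  ext f
  constructor
  · rintro ⟨k, g, rfl⟩
    exact ⟨_, (φ k).2, g, rfl⟩
  · rintro ⟨T, hT, g, rfl⟩
    exact ⟨φ.symm ⟨T, hT⟩, g, congrArg (fun b : B => b.1 g) (φ.apply_symm_apply ⟨T, hT⟩)⟩

theorem isNondegenerateSubalgebraOfCompacts_of_equiv {L : Type v} [NonUnitalRing L] [StarRing L]
    [Module ℂ L] {X : Type u} (e : L ≃⋆ₐ[ℂ] compactOps (EllTwo X)) :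
    CantorBendixson.IsNondegenerateSubalgebraOfCompacts L X := by
  classical
  refine ⟨compactOps (EllTwo X), le_rfl, isClosed_compactOps, ?_, ⟨e⟩⟩
  refine eq_top_of_stdBasis_mem (Submodule.isClosed_topologicalClosure _) fun x =>
    Submodule.le_topologicalClosure _ (Submodule.subset_span
      ⟨matrixUnit x x, isCompactOperator_matrixUnit x x, stdBasis X x, ?_⟩)
  rw [matrixUnit_apply, stdBasis_apply, if_pos rfl, one_smul]

theorem CantorBendixson.isWidth_of_forall_layer_equiv {A : Type u} [NonUnitalCStarAlgebra A]
    {S : CantorBendixson A} {κ : Cardinal.{u}} (hκ : ℵ₀ ≤ κ) (hS : S.height ≠ 0)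
    (h : ∀ α, α < S.height → Nonempty (S.layer α ≃⋆ₐ[ℂ] compactOps (EllTwo κ.out))) :
    S.IsWidth κ := by
  have : Infinite κ.out := infinite_iff.2 (by rwa [mk_out])
  constructor
  · rintro μ ⟨α, hα, hμ⟩
    obtain ⟨e⟩ := h α hα
    simpa only [mk_out] using mk_le_of_isNondegenerateSubalgebraOfCompacts e hμ
  · intro μ hμ
    have hpos : 0 < S.height := pos_iff_ne_zero.2 hS
    obtain ⟨e⟩ := h 0 hpos
    exact hμ ⟨0, hpos, isNondegenerateSubalgebraOfCompacts_of_equiv e⟩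

end Width

/-! ### The algebra spanned by all levels -/

section Levels

variable {I K : Type u} [LinearOrder I] [Zero K]

/-- The index set of the basis of the underlying Hilbert space. The factor `ℕ` makes the algebra
built below stable. -/
abbrev LevelIndex (I K : Type u) [Zero K] : Type u := (I →₀ K) × ℕ

/-- The part of an element of `LevelIndex I K` that is visible from level `i` on. -/
abbrev UpperIndex (K : Type u) [Zero K] (i : I) : Type u := ({k // ¬k < i} →₀ K) × ℕ

/-- The part of an element of `LevelIndex I K` below level `i`. -/
abbrev LowerIndex (K : Type u) [Zero K] (i : I) : Type u := {k // k < i} →₀ K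

/-- The bounded operators on the underlying Hilbert space. -/
abbrev LevelOps (I K : Type u) [Zero K] : Type u :=
  EllTwo (LevelIndex I K) →L[ℂ] EllTwo (LevelIndex I K)

/-- The bounded operators on the Hilbert space of what is visible from level `i` on. -/
abbrev UpperOps (K : Type u) [Zero K] (i : I) : Type u :=
  EllTwo (UpperIndex K i) →L[ℂ] EllTwo (UpperIndex K i)

/-- The decomposition of an element of `LevelIndex I K` into its parts above and below `i`. -/
def splitAt (K : Type u) [Zero K] (i : I) : LevelIndex I K ≃ UpperIndex K i × LowerIndex K i :=
  ((((Finsupp.equivCongrLeft (Equiv.sumCompl (· < i)).symm).trans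
    Finsupp.sumFinsuppEquivProdFinsupp).prodCongr (.refl ℕ)).trans (.prodAssoc _ _ _)).trans
      (.prodComm _ _)

theorem splitAt_lower_apply (i : I) (x : LevelIndex I K) (k : {k // k < i}) :
    (splitAt K i x).2 k = x.1 k := rfl

theorem splitAt_upper_apply (i : I) (x : LevelIndex I K) (k : {k // ¬k < i}) :
    (splitAt K i x).1.1 k = x.1 k := rfl

theorem splitAt_symm_apply_of_lt {i k : I} (hk : k < i) (y : UpperIndex K i) (z : LowerIndex K i) :
    ((splitAt K i).symm (y, z)).1 k = z ⟨k, hk⟩ := by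
  rw [← splitAt_lower_apply i _ ⟨k, hk⟩, Equiv.apply_symm_apply]

theorem splitAt_symm_apply_of_not_lt {i k : I} (hk : ¬k < i) (y : UpperIndex K i)
    (z : LowerIndex K i) : ((splitAt K i).symm (y, z)).1 k = y.1 ⟨k, hk⟩ := by
  rw [← splitAt_upper_apply i _ ⟨k, hk⟩, Equiv.apply_symm_apply]

theorem splitAt_symm_upper_eq {i j : I} (hij : i ≤ j) (y : UpperIndex K i) (z z' : LowerIndex K i) :
    (splitAt K j ((splitAt K i).symm (y, z))).1 =
      (splitAt K j ((splitAt K i).symm (y, z'))).1 := by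
  refine Prod.ext (Finsupp.ext fun k => ?_) rfl
  have hk : ¬(k : I) < i := fun h => k.2 (h.trans_le hij)
  rw [splitAt_upper_apply, splitAt_upper_apply, splitAt_symm_apply_of_not_lt hk,
    splitAt_symm_apply_of_not_lt hk]

theorem splitAt_symm_lower_eq_iff {i j : I} (hij : i ≤ j) (y y' : UpperIndex K i)
    (z z' : LowerIndex K i) :
    (splitAt K j ((splitAt K i).symm (y, z))).2 = (splitAt K j ((splitAt K i).symm (y', z'))).2 ↔
      z = z' ∧ (splitAt K j ((splitAt K i).symm (y, 0))).2 =
        (splitAt K j ((splitAt K i).symm (y', 0))).2 := by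
  simp only [Finsupp.ext_iff, splitAt_lower_apply, Subtype.forall]
  constructor
  · intro h
    refine ⟨fun k hk => ?_, fun k hk => ?_⟩
    · simpa only [splitAt_symm_apply_of_lt hk] using h k (hk.trans_le hij)
    · by_cases hki : k < i
      · simp only [splitAt_symm_apply_of_lt hki]
      · simpa only [splitAt_symm_apply_of_not_lt hki] using h k hk
  · rintro ⟨hz, hy⟩ k hk
    by_cases hki : k < i
    · simpa only [splitAt_symm_apply_of_lt hki] using hz k hki
    · simpa only [splitAt_symm_apply_of_not_lt hki] using hy k hk

variable (K) in
/-- The embedding of `𝓑(ℓ₂(UpperIndex K i))` into the operators on the whole space, by operators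
which do not touch what is below level `i`. -/
def levelHom (i : I) : UpperOps K i →⋆ₙₐ[ℂ] LevelOps I K :=
  amplify (splitAt K i)

theorem exists_levelHom_eq_levelHom {i j : I} (hij : i ≤ j) (T : UpperOps K j) :
    ∃ S, levelHom K j T = levelHom K i S := by
  classical
  refine exists_eq_amplify (splitAt K i) 0 fun y z y' z' => ?_
  rw [levelHom, amplify_matrix, amplify_matrix, splitAt_symm_upper_eq hij y z 0,
    splitAt_symm_upper_eq hij y' z' 0]
  simp only [splitAt_symm_lower_eq_iff hij y y' z z', ite_and]

/-- The closed linear span of the compact operators at the levels in `S`. -/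
def levelSpan (K : Type u) [Zero K] (S : Set I) : Submodule ℂ (LevelOps I K) :=
  (Submodule.span ℂ {T | ∃ i ∈ S, ∃ k : UpperOps K i,
    IsCompactOperator k ∧ levelHom K i k = T}).topologicalClosure

theorem isClosed_levelSpan (S : Set I) : IsClosed (levelSpan K S : Set (LevelOps I K)) :=
  Submodule.isClosed_topologicalClosure _

theorem levelHom_mem_levelSpan {S : Set I} {i : I} (hi : i ∈ S) {k : UpperOps K i}
    (hk : IsCompactOperator k) : levelHom K i k ∈ levelSpan K S :=
  Submodule.le_topologicalClosure _ (Submodule.subset_span ⟨i, hi, k, hk, rfl⟩)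

theorem levelSpan_le {S : Set I} {M : Submodule ℂ (LevelOps I K)}
    (hM : IsClosed (M : Set (LevelOps I K)))
    (h : ∀ i ∈ S, ∀ k : UpperOps K i, IsCompactOperator k → levelHom K i k ∈ M) :
    levelSpan K S ≤ M :=
  Submodule.topologicalClosure_minimal _ (Submodule.span_le.2
    (by rintro _ ⟨i, hi, k, hk, rfl⟩; exact h i hi k hk)) hM

theorem levelSpan_mono {S S' : Set I} (h : S ⊆ S') : levelSpan K S ≤ levelSpan K S' :=
  levelSpan_le (isClosed_levelSpan S') fun _ hi _ hk => levelHom_mem_levelSpan (h hi) hk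

theorem levelSpan_empty : levelSpan K (∅ : Set I) = ⊥ :=
  le_bot_iff.1 (levelSpan_le isClosed_singleton fun _ hi => hi.elim)

theorem levelSpan_iUnion_subset {ι : Type*} [Nonempty ι] {S : ι → Set I}
    (hS : Directed (· ⊆ ·) S) :
    (levelSpan K (⋃ t, S t) : Set (LevelOps I K)) ⊆ closure (⋃ t, levelSpan K (S t)) := by
  have hdir : Directed (· ≤ ·) fun t => levelSpan K (S t) :=
    fun t t' => (hS t t').imp fun _ h => ⟨levelSpan_mono h.1, levelSpan_mono h.2⟩
  rw [← Submodule.coe_iSup_of_directed _ hdir, ← Submodule.topologicalClosure_coe]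
  refine levelSpan_le (Submodule.isClosed_topologicalClosure _) fun i hi k hk => ?_
  obtain ⟨t, ht⟩ := Set.mem_iUnion.1 hi
  exact Submodule.le_topologicalClosure _
    (Submodule.mem_iSup_of_mem t (levelHom_mem_levelSpan ht hk))

theorem star_mem_levelSpan {S : Set I} {a : LevelOps I K} (ha : a ∈ levelSpan K S) :
    star a ∈ levelSpan K S := by
  let M : Submodule ℂ (LevelOps I K) := (levelSpan K S).comap (starLinearEquiv ℂ).toLinearMap
  suffices levelSpan K S ≤ M from this ha
  refine levelSpan_le ((isClosed_levelSpan S).preimage continuous_star) fun i hi k hk => ?_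
  change star (levelHom K i k) ∈ levelSpan K S
  rw [← map_star]
  exact levelHom_mem_levelSpan hi (isCompactOperator_adjoint hk)

theorem levelHom_mul_levelHom_mem {S : Set I} {i j : I} (hS : min i j ∈ S)
    {k : UpperOps K i} {l : UpperOps K j} (hk : IsCompactOperator k) (hl : IsCompactOperator l) :
    levelHom K i k * levelHom K j l ∈ levelSpan K S := by
  rcases le_total i j with hij | hji
  · rw [min_eq_left hij] at hS
    obtain ⟨T, hT⟩ := exists_levelHom_eq_levelHom hij l
    rw [hT, ← map_mul]
    exact levelHom_mem_levelSpan hS (hk.comp_clm T)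
  · rw [min_eq_right hji] at hS
    obtain ⟨T, hT⟩ := exists_levelHom_eq_levelHom hji k
    rw [hT, ← map_mul]
    exact levelHom_mem_levelSpan hS (hl.clm_comp T)

theorem mul_mem_levelSpan {S S' S'' : Set I} (hS : ∀ i ∈ S, ∀ j ∈ S', min i j ∈ S'')
    {a b : LevelOps I K} (ha : a ∈ levelSpan K S) (hb : b ∈ levelSpan K S') :
    a * b ∈ levelSpan K S'' := by
  let M (T : LevelOps I K) := (levelSpan K S'').comap (LinearMap.mulLeft ℂ T)
  let N := (levelSpan K S'').comap (LinearMap.mulRight ℂ b)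
  have hclosed := isClosed_levelSpan (K := K) S''
  have hleft {i : I} (hi : i ∈ S) {k : UpperOps K i} (hk : IsCompactOperator k) :
      levelSpan K S' ≤ M (levelHom K i k) :=
    levelSpan_le (hclosed.preimage (continuous_const_mul _)) fun j hj l hl =>
      levelHom_mul_levelHom_mem (hS i hi j hj) hk hl
  have hright : levelSpan K S ≤ N :=
    levelSpan_le (hclosed.preimage (continuous_mul_const b)) fun i hi k hk => hleft hi hk hb
  exact hright ha

/-- `levelSpan K S` as a `*`-algebra. -/
def levelAlg (K : Type u) [Zero K] (S : Set I) : NonUnitalStarSubalgebra ℂ (LevelOps I K) where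
  __ := levelSpan K S
  mul_mem' := mul_mem_levelSpan fun i hi j hj => by
    rcases min_choice i j with h | h <;> rwa [h]
  star_mem' := star_mem_levelSpan

instance isClosed_levelAlg (S : Set I) :
    IsClosed (levelAlg K S : Set (LevelOps I K)) :=
  isClosed_levelSpan S

/-- The ideal of `levelAlg K univ` belonging to an initial segment of levels. -/
def levelIdeal (K : Type u) [Zero K] {S : Set I} (hS : IsLowerSet S) :
    ClosedIdeal (levelAlg K (Set.univ : Set I)) where
  __ := (levelAlg K S).comap
    (NonUnitalStarSubalgebraClass.subtype (levelAlg K (Set.univ : Set I)))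
  isClosed := (isClosed_levelSpan S).preimage continuous_subtype_val
  mul_mem_left a _ hx := mul_mem_levelSpan (fun _ _ _ hj => hS (min_le_right _ _) hj) a.2 hx
  mul_mem_right a _ hx := mul_mem_levelSpan (fun _ hi _ _ => hS (min_le_left _ _) hi) hx a.2

theorem mem_levelIdeal {S : Set I} {hS : IsLowerSet S} {a : levelAlg K (Set.univ : Set I)} :
    a ∈ (levelIdeal K hS).carrier ↔ (a : LevelOps I K) ∈ levelSpan K S :=
  Iff.rfl

end Levels

section Splitting

theorem isClosed_map_sup {D : Type u} {B : Type v} [NormedAddCommGroup D] [NormedSpace ℂ D]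
    [CompleteSpace D] [NormedAddCommGroup B] [NormedSpace ℂ B] [CompleteSpace B]
    {σ : D →ₗ[ℂ] B} (hcont : Continuous σ) {J : Submodule ℂ B}
    (hσ : ∀ T, ∀ x ∈ J, ‖T‖ ≤ ‖σ T + x‖) (hJ : IsClosed (J : Set B))
    {M : Submodule ℂ D} (hM : IsClosed (M : Set D)) :
    IsClosed ((M.map σ ⊔ J : Submodule ℂ B) : Set B) := by
  have := hJ.completeSpace_coe
  have := hM.completeSpace_coe
  let σ' : D →L[ℂ] B := ⟨σ, hcont⟩
  let add : M × J →L[ℂ] B := (σ' ∘L M.subtypeL).coprod J.subtypeL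
  have hadd (p : M × J) : add p = σ p.1 + p.2 := rfl
  have hrange : ((M.map σ ⊔ J : Submodule ℂ B) : Set B) = Set.range add := by
    ext b
    simp only [SetLike.mem_coe, Submodule.mem_sup, Submodule.mem_map, Set.mem_range, Prod.exists,
      Subtype.exists, hadd]
    aesop
  rw [hrange]
  refine (AddMonoidHomClass.antilipschitz_of_bound add (K := 1 + ‖σ'‖₊) fun p => ?_).isClosed_range
    add.uniformContinuous
  have hfst : ‖p.1‖ ≤ ‖add p‖ := hσ p.1 p.2 p.2.2
  have hsnd : ‖p.2‖ ≤ ‖add p‖ + ‖σ'‖ * ‖add p‖ := calc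
    ‖p.2‖ = ‖add p - σ p.1‖ := by rw [hadd, add_sub_cancel_left]; rfl
    _ ≤ ‖add p‖ + ‖σ'‖ * ‖p.1‖ := (norm_sub_le _ _).trans (by gcongr; exact σ'.le_opNorm _)
    _ ≤ ‖add p‖ + ‖σ'‖ * ‖add p‖ := by gcongr
  have hnonneg : 0 ≤ ‖σ'‖ * ‖add p‖ := by positivity
  refine (max_le (hfst.trans ?_) (hsnd.trans ?_) : ‖p‖ ≤ _) <;> push_cast <;> linarith

theorem exists_starAlgHom_sub_mem {B : Type u} {D : Type v} [NonUnitalRing B] [StarRing B]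
    [Module ℂ B] [StarModule ℂ B] [NonUnitalRing D] [StarRing D] [Module ℂ D]
    (σ : D →⋆ₙₐ[ℂ] B) {A J : NonUnitalStarSubalgebra ℂ B} (hσ : ∀ T, σ T ∈ J → T = 0)
    (hleft : ∀ a ∈ A, ∀ x ∈ J, a * x ∈ J) (hright : ∀ a ∈ A, ∀ x ∈ J, x * a ∈ J)
    (hA : ∀ a ∈ A, ∃ T, a - σ T ∈ J) :
    ∃ ρ : A →⋆ₙₐ[ℂ] D, ∀ a : A, (a : B) - σ (ρ a) ∈ J := by
  choose ρ hρ using fun a : A => hA a a.2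
  have huniq {a : A} {T : D} (hT : (a : B) - σ T ∈ J) : ρ a = T := by
    refine sub_eq_zero.1 (hσ _ ?_)
    rw [map_sub, ← sub_sub_sub_cancel_left (σ T) (σ (ρ a)) (a : B)]
    exact sub_mem hT (hρ a)
  refine ⟨{ toFun := ρ, map_smul' := fun c a => huniq ?_, map_zero' := huniq ?_,
            map_add' := fun a b => huniq ?_, map_mul' := fun a b => huniq ?_,
            map_star' := fun a => huniq ?_ }, hρ⟩
  · change c • (a : B) - σ (c • ρ a) ∈ J
    rw [map_smul, ← smul_sub]
    exact J.smul_mem' c (hρ a)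
  · simp
  · change (a + b : B) - σ (ρ a + ρ b) ∈ J
    rw [map_add, add_sub_add_comm]
    exact add_mem (hρ a) (hρ b)
  · have hdecomp : (a : B) * b - σ (ρ a * ρ b) =
        (a - σ (ρ a)) * b + (a * (b - σ (ρ b)) - (a - σ (ρ a)) * (b - σ (ρ b))) := by
      rw [map_mul]
      noncomm_ring
    change (a : B) * b - σ (ρ a * ρ b) ∈ J
    rw [hdecomp]
    exact add_mem (hright b b.2 _ (hρ a))
      (sub_mem (hleft a a.2 _ (hρ b)) (mul_mem (hρ a) (hρ b)))
  · change star (a : B) - σ (star (ρ a)) ∈ J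
    rw [map_star, ← star_sub]
    exact star_mem (hρ a)

section Vanishing

variable {Z : Type w} {H : Type u} [NormedAddCommGroup H] [InnerProductSpace ℂ H]
  {E : Type v} [NormedAddCommGroup E] [InnerProductSpace ℂ E]

theorem norm_comp_linearIsometry_le (T : E →L[ℂ] E) (V : H →ₗᵢ[ℂ] E) :
    ‖T ∘L V.toContinuousLinearMap‖ ≤ ‖T‖ :=
  (T.opNorm_comp_le _).trans
    (mul_le_of_le_one_right (norm_nonneg T) V.norm_toContinuousLinearMap_le)

/-- The operators whose restrictions to the copies `V z` of `H` tend to `0` in norm along `F`. -/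
def vanishing (V : Z → H →ₗᵢ[ℂ] E) (F : Filter Z) : Submodule ℂ (E →L[ℂ] E) where
  carrier := {T | Filter.Tendsto (fun z => T ∘L (V z).toContinuousLinearMap) F (nhds 0)}
  zero_mem' := by
    simpa only [Set.mem_ofPred_eq, ContinuousLinearMap.zero_comp] using tendsto_const_nhds
  add_mem' hS hT := by
    simpa only [Set.mem_ofPred_eq, ContinuousLinearMap.add_comp, add_zero] using hS.add hT
  smul_mem' c T hT := by
    simpa only [Set.mem_ofPred_eq, ContinuousLinearMap.smul_comp, smul_zero] using hT.const_smul c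

theorem isClosed_vanishing (V : Z → H →ₗᵢ[ℂ] E) (F : Filter Z) :
    IsClosed (vanishing V F : Set (E →L[ℂ] E)) := by
  refine isClosed_of_closure_subset fun T hT => Metric.tendsto_nhds.2 fun ε hε => ?_
  obtain ⟨S, hS, hTS⟩ := Metric.mem_closure_iff.1 hT (ε / 2) (half_pos hε)
  filter_upwards [Metric.tendsto_nhds.1 hS (ε / 2) (half_pos hε)] with z hz
  rw [dist_zero_right] at hz ⊢
  calc ‖T ∘L (V z).toContinuousLinearMap‖
      = ‖(T - S) ∘L (V z).toContinuousLinearMap + S ∘L (V z).toContinuousLinearMap‖ := by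
        rw [← ContinuousLinearMap.add_comp, sub_add_cancel]
    _ ≤ ‖T - S‖ + ‖S ∘L (V z).toContinuousLinearMap‖ :=
        (norm_add_le _ _).trans (by gcongr; exact norm_comp_linearIsometry_le _ _)
    _ < ε := by rw [dist_eq_norm] at hTS; linarith

end Vanishing

end Splitting

section LevelSplitting

variable {I K : Type u} [LinearOrder I] [Zero K]

/-- The filter of elements of `LowerIndex K i` all of whose coordinates tend to infinity. -/
def lowerFilter (K : Type u) [Zero K] (i : I) : Filter (LowerIndex K i) :=
  (Filter.pi fun _ => Filter.cofinite).comap (⇑)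

theorem eventually_lowerFilter_ne {i : I} (j : {k // k < i}) (a : K) :
    ∀ᶠ z in lowerFilter K i, z j ≠ a :=
  have hj : Filter.Tendsto (fun z : LowerIndex K i => z j) (lowerFilter K i) Filter.cofinite :=
    (Filter.tendsto_eval_pi _ j).comp Filter.tendsto_comap
  hj.eventually (Filter.eventually_cofinite_ne a)

instance neBot_lowerFilter [Infinite K] (i : I) : (lowerFilter K i).NeBot := by
  classical
  refine Filter.comap_neBot fun t ht => ?_
  obtain ⟨s, hs, r, hr, hsr⟩ := Filter.mem_pi.1 ht
  choose v hv using fun j => (Filter.nonempty_of_mem (hr j))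
  refine ⟨Finsupp.onFinset hs.toFinset (fun j => if j ∈ s then v j else 0) fun j hj => ?_,
    hsr fun j hj => ?_⟩
  · simp only [ne_eq, ite_eq_right_iff, Classical.not_imp] at hj
    exact hs.mem_toFinset.2 hj.1
  · rw [Finsupp.onFinset_apply, if_pos hj]
    exact hv j

theorem levelHom_matrixUnit_comp_slice_eq_zero {i j : I} (hji : j < i) {s t : UpperIndex K j}
    {z : LowerIndex K i} (hz : z ⟨j, hji⟩ ≠ t.1 ⟨j, lt_irrefl j⟩) :
    levelHom K j (matrixUnit s t) ∘L (slice (splitAt K i) z).toContinuousLinearMap = 0 := by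
  classical
  refine clm_ext_stdBasis fun y => ?_
  obtain ⟨⟨y', z'⟩, hyz⟩ := (splitAt K j).symm.surjective ((splitAt K i).symm (y, z))
  have hne : t ≠ y' := by
    rintro rfl
    rw [← splitAt_symm_apply_of_not_lt (lt_irrefl j) t z', hyz, splitAt_symm_apply_of_lt hji] at hz
    exact hz rfl
  rw [ContinuousLinearMap.comp_apply, LinearIsometry.coe_toContinuousLinearMap, slice_stdBasis,
    ← hyz, levelHom, amplify_stdBasis, matrixUnit_apply, stdBasis_apply, if_neg hne, zero_smul,
    map_zero, zero_apply]

theorem levelSpan_Iio_le_vanishing (i : I) :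
    levelSpan K (Set.Iio i) ≤ vanishing (slice (splitAt K i)) (lowerFilter K i) := by
  have hclosed := isClosed_vanishing (slice (splitAt K i)) (lowerFilter K i)
  refine levelSpan_le hclosed fun j hj k hk => ?_
  let M : Submodule ℂ (UpperOps K j) :=
    (vanishing (slice (splitAt K i)) (lowerFilter K i)).comap
      (LinearMapClass.linearMap (levelHom K j))
  refine mem_of_forall_matrixUnit_mem (M := M) (hclosed.preimage (map_continuous (levelHom K j)))
    (fun s t => ?_) hk
  refine tendsto_const_nhds.congr' ?_
  filter_upwards [eventually_lowerFilter_ne ⟨j, hj⟩ (t.1 ⟨j, lt_irrefl j⟩)] with z hz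
  exact (levelHom_matrixUnit_comp_slice_eq_zero hj hz).symm

theorem norm_le_norm_levelHom_add [Infinite K] {i : I} (T : UpperOps K i) {x : LevelOps I K}
    (hx : x ∈ levelSpan K (Set.Iio i)) : ‖T‖ ≤ ‖levelHom K i T + x‖ := by
  let V (z : LowerIndex K i) := (slice (splitAt K i) z).toContinuousLinearMap
  have hV (z : LowerIndex K i) : V z ∘L T = levelHom K i T ∘L V z :=
    ContinuousLinearMap.ext fun f => (amplify_slice (splitAt K i) T z f).symm
  have hbound (z : LowerIndex K i) : ‖T‖ ≤ ‖levelHom K i T + x‖ + ‖x ∘L V z‖ := calc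
    ‖T‖ = ‖V z ∘L T‖ := (LinearIsometry.norm_toContinuousLinearMap_comp _).symm
    _ = ‖(levelHom K i T + x) ∘L V z - x ∘L V z‖ := by
      rw [hV, ContinuousLinearMap.add_comp, add_sub_cancel_right]
    _ ≤ ‖levelHom K i T + x‖ + ‖x ∘L V z‖ :=
      (norm_sub_le _ _).trans (by gcongr; exact norm_comp_linearIsometry_le _ _)
  have hlim : Filter.Tendsto (fun z => ‖levelHom K i T + x‖ + ‖x ∘L V z‖) (lowerFilter K i)
      (nhds ‖levelHom K i T + x‖) := by
    simpa only [norm_zero, add_zero] using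
      tendsto_const_nhds.add (levelSpan_Iio_le_vanishing i hx).norm
  exact ge_of_tendsto' hlim hbound

end LevelSplitting

section LevelRep

variable {I K : Type u} [LinearOrder I] [Zero K] [Infinite K]

theorem eq_zero_of_levelHom_mem_levelSpan_Iio {i : I} {T : UpperOps K i}
    (hT : levelHom K i T ∈ levelSpan K (Set.Iio i)) : T = 0 := by
  simpa using norm_le_norm_levelHom_add T (neg_mem hT)

theorem levelSpan_le_map_levelHom_sup {i : I} {S : Set I} {M : Submodule ℂ (UpperOps K i)}
    (hM : IsClosed (M : Set (UpperOps K i)))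
    (h : ∀ j ∈ S, i ≤ j → ∀ k : UpperOps K j, IsCompactOperator k →
      ∃ T ∈ M, levelHom K i T = levelHom K j k) :
    levelSpan K S ≤ M.map (LinearMapClass.linearMap (levelHom K i)) ⊔ levelSpan K (Set.Iio i) := by
  have hcont : Continuous (LinearMapClass.linearMap (levelHom K i)) := map_continuous (levelHom K i)
  have hnorm (T : UpperOps K i) (x) (hx : x ∈ levelSpan K (Set.Iio i)) :
      ‖T‖ ≤ ‖LinearMapClass.linearMap (levelHom K i) T + x‖ := norm_le_norm_levelHom_add T hx
  refine levelSpan_le (isClosed_map_sup hcont hnorm (isClosed_levelSpan _) hM) fun j hj k hk => ?_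
  rcases lt_or_ge j i with hji | hij
  · exact Submodule.mem_sup_right (levelHom_mem_levelSpan (Set.mem_Iio.2 hji) hk)
  · exact Submodule.mem_sup_left (h j hj hij k hk)

theorem exists_levelRep (i : I) : ∃ ρ : levelAlg K (Set.univ : Set I) →⋆ₙₐ[ℂ] UpperOps K i,
    ∀ a : levelAlg K (Set.univ : Set I),
      (a : LevelOps I K) - levelHom K i (ρ a) ∈ levelAlg K (Set.Iio i) := by
  have hmin (j k : I) (h : j < i ∨ k < i) : min j k ∈ Set.Iio i := min_lt_iff.2 h
  refine exists_starAlgHom_sub_mem (A := levelAlg K Set.univ) (J := levelAlg K (Set.Iio i))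
    (levelHom K i) (fun _ => eq_zero_of_levelHom_mem_levelSpan_Iio)
    (fun a ha x hx => mul_mem_levelSpan (fun j _ k hk => hmin j k (.inr hk)) ha hx)
    (fun a ha x hx => mul_mem_levelSpan (fun j hj k _ => hmin j k (.inl hj)) hx ha)
    fun a ha => ?_
  have hle := levelSpan_le_map_levelHom_sup (i := i) (S := Set.univ) (M := ⊤) isClosed_univ
    fun j _ hij (k : UpperOps K j) _ => by
      obtain ⟨T, hT⟩ := exists_levelHom_eq_levelHom hij k
      exact ⟨T, Submodule.mem_top, hT.symm⟩
  obtain ⟨_, ⟨T, -, rfl⟩, x, hx, rfl⟩ := Submodule.mem_sup.1 (hle ha)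
  refine ⟨T, ?_⟩
  rw [show LinearMapClass.linearMap (levelHom K i) T = levelHom K i T from rfl, add_sub_cancel_left]
  exact hx

/-- The representation of `levelAlg K univ` on the Hilbert space visible from level `i` on, which
kills the levels below `i`. -/
def levelRep (K : Type u) [Zero K] [Infinite K] (i : I) :
    levelAlg K (Set.univ : Set I) →⋆ₙₐ[ℂ] UpperOps K i :=
  (exists_levelRep i).choose

theorem sub_levelHom_levelRep_mem (i : I) (a : levelAlg K (Set.univ : Set I)) :
    (a : LevelOps I K) - levelHom K i (levelRep K i a) ∈ levelSpan K (Set.Iio i) :=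
  (exists_levelRep i).choose_spec a

theorem levelRep_eq {i : I} {a : levelAlg K (Set.univ : Set I)} {T : UpperOps K i}
    (h : (a : LevelOps I K) - levelHom K i T ∈ levelSpan K (Set.Iio i)) : levelRep K i a = T := by
  refine sub_eq_zero.1 (eq_zero_of_levelHom_mem_levelSpan_Iio ?_)
  rw [map_sub, ← sub_sub_sub_cancel_left _ _ (a : LevelOps I K)]
  exact sub_mem h (sub_levelHom_levelRep_mem i a)

theorem levelRep_eq_zero_iff {i : I} {a : levelAlg K (Set.univ : Set I)} :
    levelRep K i a = 0 ↔ (a : LevelOps I K) ∈ levelSpan K (Set.Iio i) := by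
  refine ⟨fun h => ?_, fun h => levelRep_eq (by rwa [map_zero, sub_zero])⟩
  simpa only [h, map_zero, sub_zero] using sub_levelHom_levelRep_mem i a

theorem isCompactOperator_levelRep_iff {i : I} {a : levelAlg K (Set.univ : Set I)} :
    IsCompactOperator (levelRep K i a) ↔ (a : LevelOps I K) ∈ levelSpan K (Set.Iic i) := by
  constructor
  · intro h
    rw [← sub_add_cancel (a : LevelOps I K) (levelHom K i (levelRep K i a))]
    exact add_mem (levelSpan_mono Set.Iio_subset_Iic_self (sub_levelHom_levelRep_mem i a))
      (levelHom_mem_levelSpan Set.self_mem_Iic h)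
  · intro h
    have hle := levelSpan_le_map_levelHom_sup (i := i) (S := Set.Iic i)
      (M := (compactOps (EllTwo (UpperIndex K i))).toNonUnitalSubalgebra.toSubmodule)
      isClosed_compactOps fun j hj hij k hk => by
        obtain rfl := le_antisymm hij hj
        exact ⟨k, hk, rfl⟩
    obtain ⟨_, ⟨T, hT, rfl⟩, x, hx, hax⟩ := Submodule.mem_sup.1 (hle h)
    have ha : levelRep K i a = T := by
      refine levelRep_eq ?_
      rw [← hax, show LinearMapClass.linearMap (levelHom K i) T = levelHom K i T from rfl,
        add_sub_cancel_left]
      exact hx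
    rw [ha]
    exact hT

/-- The inclusion of the compact operators at level `i` into `levelAlg K univ`. -/
def levelSec (K : Type u) [Zero K] (i : I) :
    compactOps (EllTwo (UpperIndex K i)) →⋆ₙₐ[ℂ] levelAlg K (Set.univ : Set I) :=
  NonUnitalStarAlgHom.codRestrict
    ((levelHom K i).comp (NonUnitalStarSubalgebraClass.subtype _)) _
    fun k => levelHom_mem_levelSpan (Set.mem_univ i) k.2

theorem levelRep_levelSec (i : I) (k : compactOps (EllTwo (UpperIndex K i))) :
    levelRep K i (levelSec K i k) = k :=
  levelRep_eq ((sub_self (levelHom K i k.1)).symm ▸ zero_mem _)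

end LevelRep

section LevelSeries

variable {θ : Ordinal.{u}}

/-- The levels below `α`. -/
def levelsBelow (θ α : Ordinal.{u}) : Set θ.ToType := {i | (i.toOrd : Ordinal) < α}

theorem mem_levelsBelow {α : Ordinal.{u}} {i : θ.ToType} :
    i ∈ levelsBelow θ α ↔ (i.toOrd : Ordinal) < α := Iff.rfl

theorem isLowerSet_levelsBelow (θ α : Ordinal.{u}) : IsLowerSet (levelsBelow θ α) :=
  fun _ _ hij hi => mem_levelsBelow.2 <|
    lt_of_le_of_lt (Ordinal.ToType.mk.symm.monotone hij) (mem_levelsBelow.1 hi)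

theorem levelsBelow_mono {α β : Ordinal.{u}} (h : α ≤ β) :
    levelsBelow θ α ⊆ levelsBelow θ β := fun _ hi =>
  mem_levelsBelow.2 ((mem_levelsBelow.1 hi).trans_le h)

theorem levelsBelow_coe (α : Set.Iio θ) : levelsBelow θ α = Set.Iio (Ordinal.ToType.mk α) :=
  Set.ext fun _ => mem_levelsBelow.trans (Ordinal.ToType.mk.symm_apply_lt (x := α))

theorem levelsBelow_succ (α : Set.Iio θ) :
    levelsBelow θ (Order.succ (α : Ordinal)) = Set.Iic (Ordinal.ToType.mk α) :=
  Set.ext fun _ => mem_levelsBelow.trans <|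
    Order.lt_succ_iff.trans (Ordinal.ToType.mk.symm_apply_le (x := α))

theorem levelsBelow_of_isSuccLimit {γ : Ordinal.{u}} (hγ : Order.IsSuccLimit γ) :
    levelsBelow θ γ = ⋃ α : Set.Iio γ, levelsBelow θ α := by
  refine subset_antisymm (fun i hi => ?_) (Set.iUnion_subset fun α => levelsBelow_mono α.2.le)
  exact Set.mem_iUnion.2
    ⟨⟨_, hγ.succ_lt (mem_levelsBelow.1 hi)⟩, mem_levelsBelow.2 (Order.lt_succ _)⟩

theorem levelIdeal_carrier_eq_closure {K : Type u} [Zero K] {γ : Ordinal.{u}}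
    (hγ : Order.IsSuccLimit γ) :
    (levelIdeal K (isLowerSet_levelsBelow θ γ)).carrier =
      closure (⋃ α ∈ Set.Iio γ, (levelIdeal K (isLowerSet_levelsBelow θ α)).carrier) := by
  refine subset_antisymm (fun a ha => ?_) (closure_minimal (Set.iUnion₂_subset fun α hα a ha =>
    levelSpan_mono (levelsBelow_mono (le_of_lt hα)) ha) (levelIdeal K _).isClosed)
  have : Nonempty (Set.Iio γ) := ⟨⟨0, hγ.bot_lt⟩⟩
  have hdir : Directed (· ⊆ ·) fun α : Set.Iio γ => levelsBelow θ α :=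
    Monotone.directed_le fun _ _ h => levelsBelow_mono h
  rw [mem_levelIdeal, levelsBelow_of_isSuccLimit hγ] at ha
  refine closure_subtype.2 (closure_mono ?_ (levelSpan_iUnion_subset hdir ha))
  refine Set.iUnion_subset fun α x hx => ?_
  exact ⟨⟨x, levelSpan_mono (Set.subset_univ _) hx⟩, Set.mem_biUnion α.2 hx, rfl⟩

/-- The composition series of the algebra with levels indexed by `θ`. -/
def levelSeries (θ : Ordinal.{u}) (K : Type u) [Zero K] [Infinite K] :
    CompositionSeries (levelAlg K (Set.univ : Set θ.ToType)) θ
      fun α => EllTwo (UpperIndex K (Ordinal.ToType.mk α)) where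
  ideal α := levelIdeal K (isLowerSet_levelsBelow θ α)
  ideal_zero := by
    have hempty : levelsBelow θ 0 = ∅ := Set.eq_empty_of_forall_notMem fun _ hi =>
      not_lt_zero (mem_levelsBelow.1 hi)
    ext a
    rw [mem_levelIdeal, hempty, levelSpan_empty, Submodule.mem_bot, ZeroMemClass.coe_eq_zero]
    rfl
  mono α β hαβ _ _ ha := levelSpan_mono (levelsBelow_mono hαβ) ha
  limit γ _ hγ := levelIdeal_carrier_eq_closure hγ
  ideal_top := by
    have htop : levelsBelow θ θ = Set.univ := Set.eq_univ_of_forall fun i => i.toOrd.2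
    refine Set.eq_univ_of_forall fun a => ?_
    rw [mem_levelIdeal, htop]
    exact a.2
  rep α := levelRep K (Ordinal.ToType.mk α)
  rep_eq_zero_iff α a := by rw [levelRep_eq_zero_iff, mem_levelIdeal, levelsBelow_coe]
  isCompactOperator_rep_iff α a := by
    rw [isCompactOperator_levelRep_iff, mem_levelIdeal, levelsBelow_succ]
  sec α := levelSec K (Ordinal.ToType.mk α)
  rep_sec α := levelRep_levelSec (Ordinal.ToType.mk α)

end LevelSeries

/-! ### Tensor products of operators and stability -/

section Kronecker

variable {X : Type u} {Y : Type v} {Z : Type w} (e : X ≃ Y × Z)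

theorem amplify_apply (T : EllTwo Y →L[ℂ] EllTwo Y) (v : EllTwo X) (y : Y) (z : Z) :
    amplify e T v (e.symm (y, z)) =
      T (ContinuousLinearMap.adjoint (slice e z).toContinuousLinearMap v) y := by
  have hcomm : ContinuousLinearMap.adjoint (slice e z).toContinuousLinearMap ∘L amplify e T =
      T ∘L ContinuousLinearMap.adjoint (slice e z).toContinuousLinearMap := by
    classical
    refine clm_ext_stdBasis fun x => ?_
    obtain ⟨⟨y', z'⟩, rfl⟩ := e.symm.surjective x
    have hadj : ContinuousLinearMap.adjoint (slice e z).toContinuousLinearMap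
        (stdBasis X (e.symm (y', z'))) = if z' = z then stdBasis Y y' else 0 := by
      refine lp.ext (funext fun y'' => ?_)
      rw [adjoint_slice_apply, ← slice_stdBasis, slice_apply]
      split_ifs <;> rfl
    rw [ContinuousLinearMap.comp_apply, ContinuousLinearMap.comp_apply, hadj, amplify_stdBasis]
    refine lp.ext (funext fun y'' => ?_)
    rw [adjoint_slice_apply, slice_apply]
    split_ifs
    · rfl
    · rw [map_zero]; rfl
  rw [← adjoint_slice_apply]
  exact congrArg (fun R : EllTwo X →L[ℂ] EllTwo Y => R v y) hcomm

/-- The operator `a ⊗ b` on `ℓ₂(X) ≅ ℓ₂(Y) ⊗ ℓ₂(Z)`. -/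
def kron : (EllTwo Y →L[ℂ] EllTwo Y) →ₗ[ℂ] (EllTwo Z →L[ℂ] EllTwo Z) →ₗ[ℂ]
    (EllTwo X →L[ℂ] EllTwo X) :=
  (LinearMap.mul ℂ (EllTwo X →L[ℂ] EllTwo X)).compl₁₂ (LinearMapClass.linearMap (amplify e))
    (LinearMapClass.linearMap (amplify (e.trans (.prodComm Y Z))))

theorem kron_eq (a : EllTwo Y →L[ℂ] EllTwo Y) (b : EllTwo Z →L[ℂ] EllTwo Z) :
    kron e a b = amplify e a * amplify (e.trans (.prodComm Y Z)) b := rfl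

theorem kron_matrix (a : EllTwo Y →L[ℂ] EllTwo Y) (b : EllTwo Z →L[ℂ] EllTwo Z) (x x' : X) :
    kron e a b (stdBasis X x) x' =
      a (stdBasis Y (e x).1) (e x').1 * b (stdBasis Z (e x).2) (e x').2 := by
  classical
  obtain ⟨⟨y, z⟩, rfl⟩ := e.symm.surjective x
  obtain ⟨⟨y', z'⟩, rfl⟩ := e.symm.surjective x'
  let e' := e.trans (.prodComm Y Z)
  have hslice : ContinuousLinearMap.adjoint (slice e z').toContinuousLinearMap
      (slice e' y (b (stdBasis Z z))) = b (stdBasis Z z) z' • stdBasis Y y := by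
    refine lp.ext (funext fun y'' => ?_)
    rw [adjoint_slice_apply, lp.coeFn_smul, Pi.smul_apply, stdBasis_apply, smul_eq_mul, mul_ite,
      mul_one, mul_zero]
    exact (slice_apply e' y y'' _ z').trans (if_congr eq_comm rfl rfl)
  have hb : amplify e' b (stdBasis X (e.symm (y, z))) = slice e' y (b (stdBasis Z z)) :=
    amplify_stdBasis e' b z y
  rw [kron_eq, mul_apply_eq_comp, hb, amplify_apply, hslice, map_smul,
    lp.coeFn_smul, Pi.smul_apply, smul_eq_mul, mul_comm]
  simp only [Equiv.apply_symm_apply]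

theorem kron_prodComm (a : EllTwo Y →L[ℂ] EllTwo Y) (b : EllTwo Z →L[ℂ] EllTwo Z) :
    kron (e.trans (.prodComm Y Z)) b a = kron e a b :=
  clm_ext_matrix fun x x' => by
    rw [kron_matrix, kron_matrix, mul_comm]
    rfl

theorem commute_amplify (a : EllTwo Y →L[ℂ] EllTwo Y) (b : EllTwo Z →L[ℂ] EllTwo Z) :
    Commute (amplify e a) (amplify (e.trans (.prodComm Y Z)) b) :=
  (kron_prodComm e a b).symm

theorem kron_mul_kron (a a' : EllTwo Y →L[ℂ] EllTwo Y) (b b' : EllTwo Z →L[ℂ] EllTwo Z) :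
    kron e (a * a') (b * b') = kron e a b * kron e a' b' := by
  rw [kron_eq, kron_eq, kron_eq, map_mul, map_mul]
  exact (commute_amplify e a' b).mul_mul_mul_comm _ _

theorem star_kron (a : EllTwo Y →L[ℂ] EllTwo Y) (b : EllTwo Z →L[ℂ] EllTwo Z) :
    star (kron e a b) = kron e (star a) (star b) := by
  rw [kron_eq, kron_eq, (commute_amplify e a b).eq, star_mul, map_star, map_star]

theorem continuous_kron_left (b : EllTwo Z →L[ℂ] EllTwo Z) : Continuous (kron e · b) :=
  (map_continuous (amplify e)).mul continuous_const

theorem continuous_kron_right (a : EllTwo Y →L[ℂ] EllTwo Y) : Continuous (kron e a) :=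
  continuous_const.mul (map_continuous (amplify (e.trans (.prodComm Y Z))))

theorem kron_matrixUnit (s t : Y) (k l : Z) :
    kron e (matrixUnit s t) (matrixUnit k l) = matrixUnit (e.symm (s, k)) (e.symm (t, l)) := by
  classical
  refine clm_ext_matrix fun x x' => ?_
  obtain ⟨⟨y, z⟩, rfl⟩ := e.symm.surjective x
  obtain ⟨⟨y', z'⟩, rfl⟩ := e.symm.surjective x'
  simp only [kron_matrix, matrixUnit_apply, lp.coeFn_smul, Pi.smul_apply, stdBasis_apply,
    smul_eq_mul, Equiv.apply_symm_apply, Equiv.apply_eq_iff_eq, Prod.mk.injEq]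
  grind

theorem isCompactOperator_kron {a : EllTwo Y →L[ℂ] EllTwo Y} {b : EllTwo Z →L[ℂ] EllTwo Z}
    (ha : IsCompactOperator a) (hb : IsCompactOperator b) : IsCompactOperator (kron e a b) := by
  let M := (compactOps (EllTwo X)).toNonUnitalSubalgebra.toSubmodule
  have hM : IsClosed (M : Set (EllTwo X →L[ℂ] EllTwo X)) := isClosed_compactOps
  have hunit (s t : Y) : kron e (matrixUnit s t) b ∈ M :=
    mem_of_forall_matrixUnit_mem (M := M.comap (kron e (matrixUnit s t)))
      (hM.preimage (continuous_kron_right e _))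
      (fun k l => show kron e (matrixUnit s t) (matrixUnit k l) ∈ M by
        rw [kron_matrixUnit]; exact isCompactOperator_matrixUnit _ _) hb
  exact mem_of_forall_matrixUnit_mem (M := M.comap ((kron e).flip b))
    (hM.preimage (continuous_kron_left e b)) hunit ha

/-- The matrix entry of an operator in row `y` and column `x`. -/
def matrixEntry (x y : X) : (EllTwo X →L[ℂ] EllTwo X) →ₗ[ℂ] ℂ where
  toFun T := T (stdBasis X x) y
  map_add' _ _ := rfl
  map_smul' _ _ := rfl

end Kronecker

theorem lift_injective_of_separating {A : Type u} {B : Type v} {C : Type w} [AddCommGroup A]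
    [Module ℂ A] [AddCommGroup B] [Module ℂ B] [AddCommGroup C] [Module ℂ C]
    (φ : A →ₗ[ℂ] B →ₗ[ℂ] C) {ι ι' : Type*} (p : ι → A →ₗ[ℂ] ℂ) (q : ι' → B →ₗ[ℂ] ℂ)
    (r : ι → ι' → C →ₗ[ℂ] ℂ) (hr : ∀ i j a b, r i j (φ a b) = p i a * q j b)
    (hp : ∀ a, (∀ i, p i a = 0) → a = 0) (hq : ∀ b, (∀ j, q j b = 0) → b = 0) :
    Function.Injective (TensorProduct.lift φ) := by
  rw [injective_iff_map_eq_zero]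
  intro t ht
  let β := Module.Free.chooseBasis ℂ B
  obtain ⟨c, rfl⟩ := TensorProduct.eq_repr_basis_right β t
  simp only [Finsupp.sum, map_sum, TensorProduct.lift.tmul] at ht
  have hsum (i : ι) : ∑ k ∈ c.support, p i (c k) • β k = 0 := by
    refine hq _ fun j => ?_
    have hrow := congrArg (r i j) ht
    simpa only [map_sum, map_smul, map_zero, hr, smul_eq_mul] using hrow
  suffices c = 0 by rw [this, Finsupp.sum_zero_index]
  ext1 k
  refine hp _ fun i => ?_
  by_cases hk : k ∈ c.support
  · exact linearIndependent_iff'.1 β.linearIndependent c.support _ (hsum i) k hk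
  · rw [Finsupp.notMem_support_iff.1 hk, map_zero]

section TensorProduct

variable {X : Type u} {Y : Type v} {Z : Type w} (e : X ≃ Y × Z)
  {A : NonUnitalStarSubalgebra ℂ (EllTwo Y →L[ℂ] EllTwo Y)}
  {B : NonUnitalStarSubalgebra ℂ (EllTwo Z →L[ℂ] EllTwo Z)}
  {C : NonUnitalStarSubalgebra ℂ (EllTwo X →L[ℂ] EllTwo X)}
  (hmem : ∀ a ∈ A, ∀ b ∈ B, kron e a b ∈ C)

/-- The tensor product of operators restricted to algebras of operators. -/
def kronRestrict : A →ₗ[ℂ] B →ₗ[ℂ] C :=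
  LinearMap.mk₂ ℂ (fun a b => ⟨kron e a b, hmem a a.2 b b.2⟩)
    (fun a a' b => Subtype.ext (LinearMap.map_add₂ (kron e) (a : EllTwo Y →L[ℂ] EllTwo Y) a' b))
    (fun c a b => Subtype.ext (LinearMap.map_smul₂ (kron e) c (a : EllTwo Y →L[ℂ] EllTwo Y) b))
    (fun a b b' => Subtype.ext (map_add (kron e a) (b : EllTwo Z →L[ℂ] EllTwo Z) b'))
    (fun c a b => Subtype.ext (map_smul (kron e a) c (b : EllTwo Z →L[ℂ] EllTwo Z)))

theorem kronRestrict_injective : Function.Injective (TensorProduct.lift (kronRestrict e hmem)) :=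
  lift_injective_of_separating (kronRestrict e hmem)
    (fun s : Y × Y => matrixEntry s.1 s.2 ∘ₗ A.toNonUnitalSubalgebra.toSubmodule.subtype)
    (fun t : Z × Z => matrixEntry t.1 t.2 ∘ₗ B.toNonUnitalSubalgebra.toSubmodule.subtype)
    (fun s t => matrixEntry (e.symm (s.1, t.1)) (e.symm (s.2, t.2)) ∘ₗ
      C.toNonUnitalSubalgebra.toSubmodule.subtype)
    (fun s t a b => (kron_matrix e (a : EllTwo Y →L[ℂ] EllTwo Y) b _ _).trans
      (by simp only [Equiv.apply_symm_apply]; rfl))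
    (fun _ h => Subtype.ext (clm_ext_matrix fun x y => h (x, y)))
    (fun _ h => Subtype.ext (clm_ext_matrix fun x y => h (x, y)))

theorem denseRange_kronRestrict (hdense : ∀ M : Submodule ℂ (EllTwo X →L[ℂ] EllTwo X),
      IsClosed (M : Set (EllTwo X →L[ℂ] EllTwo X)) →
      (∀ a ∈ A, ∀ b ∈ B, kron e a b ∈ M) → ∀ c ∈ C, c ∈ M) :
    DenseRange (TensorProduct.lift (kronRestrict e hmem)) := fun c => by
  let incl : C →ₗ[ℂ] EllTwo X →L[ℂ] EllTwo X := C.toNonUnitalSubalgebra.toSubmodule.subtype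
  let R := LinearMap.range (incl ∘ₗ TensorProduct.lift (kronRestrict e hmem))
  have hR : (R : Set (EllTwo X →L[ℂ] EllTwo X)) =
      (↑) '' Set.range (TensorProduct.lift (kronRestrict e hmem)) := by
    rw [← Set.range_comp]
    rfl
  rw [closure_subtype, ← hR, ← Submodule.topologicalClosure_coe]
  refine hdense _ R.isClosed_topologicalClosure (fun a ha b hb => ?_) c c.2
  exact R.le_topologicalClosure ⟨⟨a, ha⟩ ⊗ₜ ⟨b, hb⟩, rfl⟩

include hmem in
theorem isCStarTensorProduct_of_kron [IsClosed (C : Set (EllTwo X →L[ℂ] EllTwo X))]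
    (hdense : ∀ M : Submodule ℂ (EllTwo X →L[ℂ] EllTwo X),
      IsClosed (M : Set (EllTwo X →L[ℂ] EllTwo X)) →
      (∀ a ∈ A, ∀ b ∈ B, kron e a b ∈ M) → ∀ c ∈ C, c ∈ M) :
    IsCStarTensorProduct A B C :=
  ⟨kronRestrict e hmem, fun _ _ _ _ => Subtype.ext (kron_mul_kron e _ _ _ _),
    fun _ _ => Subtype.ext (star_kron e _ _).symm, kronRestrict_injective e hmem,
    denseRange_kronRestrict e hmem hdense⟩

end TensorProduct

section LevelStability

variable {I K : Type u} [LinearOrder I] [Zero K]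

/-- The bijection `P × ℕ ≃ (P × ℕ) × ℕ` given by a pairing function on `ℕ`. -/
def splitNat (P : Type u) : P × ℕ ≃ (P × ℕ) × ℕ :=
  ((Equiv.refl P).prodCongr Nat.pairEquiv.symm).trans (Equiv.prodAssoc P ℕ ℕ).symm

theorem kron_levelHom (i : I) (k : UpperOps K i) (b : EllTwo ℕ →L[ℂ] EllTwo ℕ) :
    kron (splitNat (I →₀ K)) (levelHom K i k) b =
      levelHom K i (kron (splitNat ({j // ¬j < i} →₀ K)) k b) := by
  classical
  refine clm_ext_matrix fun x x' => ?_
  rw [kron_matrix, levelHom, amplify_matrix, amplify_matrix, kron_matrix, ite_zero_mul]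
  rfl

theorem kron_mem_levelSpan {S : Set I} {a : LevelOps I K} {b : EllTwo ℕ →L[ℂ] EllTwo ℕ}
    (ha : a ∈ levelSpan K S) (hb : IsCompactOperator b) :
    kron (splitNat (I →₀ K)) a b ∈ levelSpan K S := by
  let M := (levelSpan K S).comap ((kron (splitNat (I →₀ K))).flip b)
  suffices levelSpan K S ≤ M from this ha
  refine levelSpan_le ((isClosed_levelSpan S).preimage (continuous_kron_left _ b))
    fun i hi k hk => ?_
  change kron (splitNat (I →₀ K)) (levelHom K i k) b ∈ levelSpan K S
  rw [kron_levelHom]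
  exact levelHom_mem_levelSpan hi (isCompactOperator_kron _ hk hb)

theorem levelSpan_le_of_kron_mem {S : Set I} {M : Submodule ℂ (LevelOps I K)}
    (hM : IsClosed (M : Set (LevelOps I K)))
    (h : ∀ a ∈ levelSpan K S, ∀ b ∈ compactOps (EllTwo ℕ), kron (splitNat (I →₀ K)) a b ∈ M) :
    levelSpan K S ≤ M := by
  refine levelSpan_le hM fun i hi k hk => ?_
  refine mem_of_forall_matrixUnit_mem (M := M.comap (LinearMapClass.linearMap (levelHom K i)))
    (hM.preimage (map_continuous (levelHom K i))) (fun s t => ?_) hk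
  let e := splitNat ({j // ¬j < i} →₀ K)
  have hunit : matrixUnit s t =
      kron e (matrixUnit (e s).1 (e t).1) (matrixUnit (e s).2 (e t).2) := by
    simp only [kron_matrixUnit, Prod.mk.eta, Equiv.symm_apply_apply]
  change levelHom K i (matrixUnit s t) ∈ M
  rw [hunit, ← kron_levelHom]
  exact h _ (levelHom_mem_levelSpan hi (isCompactOperator_matrixUnit _ _)) _
    (isCompactOperator_matrixUnit _ _)

theorem isStable_levelAlg (S : Set I) : IsStable (levelAlg K S) :=
  ⟨levelAlg K S, inferInstance,
    isCStarTensorProduct_of_kron (splitNat (I →₀ K)) (fun _ ha _ hb => kron_mem_levelSpan ha hb)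
      (fun _ hM h _ hc => levelSpan_le_of_kron_mem hM h hc),
    ⟨StarAlgEquiv.refl ℂ _⟩⟩

end LevelStability

section Cardinality

open Cardinal

theorem mk_upperIndex {I K : Type u} [LinearOrder I] [Zero K] [Infinite K] (h : #I ≤ #K) (i : I) :
    #(UpperIndex K i) = #K := by
  have : Nonempty {k // ¬k < i} := ⟨⟨i, lt_irrefl i⟩⟩
  calc #(UpperIndex K i) = max #{k // ¬k < i} #K * ℵ₀ := by
        rw [mk_prod, lift_uzero, mk_finsupp_of_infinite', mk_nat, lift_aleph0]
    _ = #K * ℵ₀ := by rw [max_eq_right ((mk_subtype_le _).trans h)]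
    _ = #K := mul_aleph0_eq (aleph0_le_mk K)

theorem mk_toType_le_of_lt_ord_succ {κ : Cardinal.{u}} {θ : Ordinal.{u}}
    (hθ : θ < (Order.succ κ).ord) : #θ.ToType ≤ κ := by
  rw [mk_toType]
  exact Order.lt_succ_iff.1 (lt_ord.1 hθ)

end Cardinality

instance nontrivial_ellTwo {X : Type u} [Nonempty X] : Nontrivial (EllTwo X) :=
  ⟨⟨stdBasis X (Classical.arbitrary X), 0, (stdBasis X).orthonormal.ne_zero _⟩⟩

theorem nonempty_layer_levelSeries_equiv {θ : Ordinal.{u}} {K : Type u} [Zero K] [Infinite K]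
    (h : Cardinal.mk θ.ToType ≤ Cardinal.mk K) (α : Set.Iio θ) :
    Nonempty ((levelSeries θ K).cantorBendixson.layer α ≃⋆ₐ[ℂ] compactOps (EllTwo K)) :=
  (Cardinal.eq.1 (mk_upperIndex h (Ordinal.ToType.mk α))).map fun e =>
    ((levelSeries θ K).layerEquiv α).trans (compactOpsCongr (ellTwoCongr e))

end ScatteredCStar

end

theorem mainTheorem6_general (κ : Cardinal.{u}) (hκ : Cardinal.aleph0 ≤ κ)
    (θ : Ordinal.{u}) (hθ : θ < (Order.succ κ).ord) :
    ∃ (A : Type u) (_ : NonUnitalCStarAlgebra A) (S : ScatteredCStar.CantorBendixson A),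
      ScatteredCStar.IsScattered A ∧
      S.height = θ ∧
      (∀ α, α < S.height →
        Nonempty (S.layer α ≃⋆ₐ[ℂ]
          ScatteredCStar.compactOps (ScatteredCStar.EllTwo κ.out))) ∧
      S.FullyNoncommutative ∧
      (θ ≠ 0 → S.IsWidth κ) ∧
      ScatteredCStar.IsStable A := by
  have : Infinite κ.out := Cardinal.infinite_iff.2 (by rwa [Cardinal.mk_out])
  let : Zero κ.out := ⟨Classical.arbitrary _⟩
  have hcard : Cardinal.mk θ.ToType ≤ Cardinal.mk κ.out := by
    rw [Cardinal.mk_out]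
    exact ScatteredCStar.mk_toType_le_of_lt_ord_succ hθ
  let C := ScatteredCStar.levelSeries θ κ.out
  have hlayer (α) (hα : α < θ) : Nonempty (C.cantorBendixson.layer α ≃⋆ₐ[ℂ]
      ScatteredCStar.compactOps (ScatteredCStar.EllTwo κ.out)) :=
    ScatteredCStar.nonempty_layer_levelSeries_equiv hcard ⟨α, hα⟩
  exact ⟨_, _, C.cantorBendixson, C.isScattered, rfl, hlayer,
    fun α hα => ⟨_, _, _, _, hlayer α hα⟩,
    fun hθ0 => ScatteredCStar.CantorBendixson.isWidth_of_forall_layer_equiv hκ hθ0 hlayer,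
    ScatteredCStar.isStable_levelAlg _⟩

theorem mainTheorem6 (κ : Cardinal.{u}) (hκ : κ.IsRegular)
    (θ : Ordinal.{u}) (hθ : θ < (Order.succ κ).ord) :
    ∃ (A : Type u) (_ : NonUnitalCStarAlgebra A) (S : ScatteredCStar.CantorBendixson A),
      ScatteredCStar.IsScattered A ∧
      S.height = θ ∧
      (∀ α, α < S.height →
        Nonempty (S.layer α ≃⋆ₐ[ℂ]
          ScatteredCStar.compactOps (ScatteredCStar.EllTwo κ.out))) ∧
      S.FullyNoncommutative ∧
      (θ ≠ 0 → S.IsWidth κ) ∧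
      ScatteredCStar.IsStable A :=
  mainTheorem6_general κ hκ.aleph0_le θ hθ
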